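/- **Setting.** Let $M$ be a smooth $n$-manifold, $E,F\to M$ smooth real vector bundles, and let $\mathcal M$ be the total space of $\Pi E\oplus\Pi F\to M$, with local coordinates $\phi^A=(x^i,\eta^a,c^\alpha)$ of parities $(0,1,1)$ and ghost numbers $(0,-1,1)$. Let $\mathcal N=\Pi T^*\mathcal M$, with coordinates $(\phi^A,\phi^*_A)$, where $\phi^*_A$ has parity $A+1$, ghost number $1-\mathrm{gh}(\phi^A)$ and momentum degree $\mathrm{Deg}=1$, and let $\Pi T\mathcal N$ have the further coordinates $d\phi^A,d\phi^*_A$ (parity shifted by one). An index $A$ or a function in an exponent of $-1$ stands for its parity (that of $\phi^A$, respectively of the function). With left derivatives, $C^\infty(\Pi T\mathcal N)$ carries the canonical even Poisson bracket $$\{f,g\}=\sum_A(-1)^{A(f+1)}\Big(\tfrac{\partial f}{\partial d\phi^*_A}\tfrac{\partial g}{\partial\phi^A}+(-1)^{f}\tfrac{\partial f}{\partial d\phi^A}\tfrac{\partial g}{\partial\phi^*_A}\Big)-(-1)^{Af}\Big(\tfrac{\partial f}{\partial\phi^A}\tfrac{\partial g}{\partial d\phi^*_A}-(-1)^{f}\tfrac{\partial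 f}{\partial\phi^*_A}\tfrac{\partial g}{\partial d\phi^A}\Big).$$ Put $\Delta=\sum_A(-1)^A d\phi^A d\phi^*_A$; the velocities are normalised so that $\{\Delta,z\}=(-1)^z dz$ for $z=\phi^A,\phi^*_A$. The odd bracket of functions on $\mathcal N$ is $(f,g)=\{\{\Delta,f\},g\}|_{\mathcal N}$. Let $\mathcal L=\{\phi^*=0=d\phi^*\}\subset\Pi T\mathcal N$; functions on $\mathcal L\cong\Pi T\mathcal M$ are regarded as differential forms on $\mathcal M$, with exterior differential $d\omega=\{\Delta,\omega\}|_{\mathcal L}$. Let $S\in C^\infty(\mathcal N)$ be a master function: $S$ is even, $\mathrm{gh}(S)=2$, $\mathrm{Deg}(S)>0$ (that is, $S|_{\phi^*=0}=0$) and $(S,S)=0$. Let $S^1$ be its component of momentum degree one, $Q=(S^1,-)$, $\Psi=\{\Delta,S\}$ and $\hat Q=\{\Psi,-\}|_{\mathcal L}$. A *projectible vector field* is a function $X=X^A(\phi)\phi^*_A$ on $\mathcal N$ with $QX=0$; a *weak Poisson vector field* is a function $V$ on $\mathcal N$ with $\mathrm{Deg}(V)>0$ and $(S,V)=0$; a *projectible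 form* is a function $\omega$ on $\mathcal L$ with $\hat Q\omega=0$. For a homogeneous function $X$ on $\mathcal N$ put $\imath_X\omega=(-1)^X\{X,\omega\}|_{\mathcal L}$. For an odd function $V$ on $\mathcal N$ with lift $\Gamma=\{\Delta,V\}$ put $\dot\omega=\{\Gamma,\omega\}|_{\mathcal L}$, and let $\mathcal L_V=d\circ\imath_V+\imath_V\circ d$ be the graded commutator of $d$ and $\imath_V$. **Proposition.** Let $V$ be a projectible or a weak Poisson vector field with $\epsilon(V)=1$, $\mathrm{gh}(V)=1$, let $X$ be a projectible vector field, homogeneous of some parity, and let $\omega$ be a projectible form. Then $$\dot{(\imath_X\omega)}=\imath_X(\dot\omega)+(-1)^X\{(V,X),\omega\}|_{\mathcal L},$$ and, in terms of the Lie derivative, $$\mathcal L_V\imath_X\omega=\imath_X\mathcal L_V\omega+(-1)^{X+V}\{(V,X),\omega\}|_{\mathcal L}.$$ -/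

import Mathlib

open scoped Manifold ContDiff
open Bundle

noncomputable section

namespace WeakKoszul

/-! ### Local coordinates on `Π T 𝒩`, where `𝒩 = Π T* ℳ` and `ℳ = Π E ⊕ Π F → M` -/

/-- Index set of the local coordinates `φ^A = (x^i, η^a, c^α)` of `ℳ`: `n = dim M`,
`m = rank E`, `k = rank F`. -/
abbrev Idx (n m k : ℕ) : Type := Fin n ⊕ (Fin m ⊕ Fin k)

/-- The index of `x^i`. -/
abbrev Idx.x {n m k : ℕ} (i : Fin n) : Idx n m k := Sum.inl i

/-- The index of `η^a`. -/
abbrev Idx.eta {n m k : ℕ} (a : Fin m) : Idx n m k := Sum.inr (Sum.inl a)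

/-- The index of `c^α`. -/
abbrev Idx.c {n m k : ℕ} (α : Fin k) : Idx n m k := Sum.inr (Sum.inr α)

/-- Grassmann parity of `φ^A`. -/
def Idx.parity {n m k : ℕ} : Idx n m k → ℕ
  | Sum.inl _ => 0
  | Sum.inr _ => 1

/-- Ghost number of `φ^A`. -/
def Idx.ghost {n m k : ℕ} : Idx n m k → ℤ
  | Sum.inl _ => 0
  | Sum.inr (Sum.inl _) => -1
  | Sum.inr (Sum.inr _) => 1

/-- Local coordinates of `Π T 𝒩`: a pair of flags and an index `A`. The first flag tells whether
the coordinate is a velocity, the second whether it belongs to a momentum. -/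
abbrev Coordinate (n m k : ℕ) : Type := (Bool × Bool) × Idx n m k

section Coordinates

variable {n m k : ℕ}

/-- `φ^A` -/
abbrev fld (A : Idx n m k) : Coordinate n m k := ((false, false), A)

/-- `φ*_A` -/
abbrev mom (A : Idx n m k) : Coordinate n m k := ((false, true), A)

/-- `dφ^A` -/
abbrev dfld (A : Idx n m k) : Coordinate n m k := ((true, false), A)

/-- `dφ*_A` -/
abbrev dmom (A : Idx n m k) : Coordinate n m k := ((true, true), A)

/-- Grassmann parity: `ε(φ*_A) = ε(φ^A) + 1` and `ε(dz) = ε(z) + 1`. Only its class modulo two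
matters. -/
def Coordinate.parity (z : Coordinate n m k) : ℕ :=
  z.2.parity + (if z.1.2 then 1 else 0) + (if z.1.1 then 1 else 0)

/-- Ghost number: `gh(φ*_A) = 1 - gh(φ^A)` and `gh(dz) = gh(z) - 1`. -/
def Coordinate.ghost (z : Coordinate n m k) : ℤ :=
  (if z.1.2 then 1 - z.2.ghost else z.2.ghost) - (if z.1.1 then 1 else 0)

end Coordinates

/-- The even coordinates. -/
abbrev EvenCoord (n m k : ℕ) : Type := {z : Coordinate n m k // Even z.parity}

/-- The odd coordinates. -/
abbrev OddCoord (n m k : ℕ) : Type := {z : Coordinate n m k // ¬ Even z.parity}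

/-- Values of the even coordinates. -/
abbrev Body (n m k : ℕ) : Type := EvenCoord n m k → ℝ

/-- The Grassmann algebra generated by the odd coordinates. -/
abbrev Grassmann (n m k : ℕ) : Type := ExteriorAlgebra ℝ (OddCoord n m k → ℝ)

/-- Grassmann-valued functions of the even coordinates; functions on a superdomain are those
which are smooth on its underlying open set, see `SmoothOn`. -/
abbrev SuperFun (n m k : ℕ) : Type := Body n m k → Grassmann n m k

instance (n m k : ℕ) : Module.Finite ℝ (Grassmann n m k) := by
  let _ : LinearOrder (OddCoord n m k) :=
    LinearOrder.lift' (Fintype.equivFin (OddCoord n m k)) (Equiv.injective _)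
  exact Module.Finite.of_basis (Pi.basisFun ℝ (OddCoord n m k)).ExteriorAlgebra

section Local

variable {n m k : ℕ}

/-- All real components of the Grassmann-valued function are smooth on the open set `W`. -/
def SmoothOn (W : Set (Body n m k)) (f : SuperFun n m k) : Prop :=
  ∀ l : Module.Dual ℝ (Grassmann n m k), ContDiffOn ℝ ∞ (fun p => l (f p)) W

/-- A coordinate as a superfunction. -/
def coord (z : Coordinate n m k) : SuperFun n m k := fun p =>
  if h : Even z.parity then algebraMap ℝ (Grassmann n m k) (p ⟨z, h⟩)
  else ExteriorAlgebra.ι ℝ (Pi.single (⟨z, h⟩ : OddCoord n m k) (1 : ℝ))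

/-- The left partial derivative with respect to a coordinate: the componentwise partial derivative
in the even case (it does not depend on the chosen basis), the left contraction with the dual
generator in the odd case. -/
def pd (z : Coordinate n m k) (f : SuperFun n m k) : SuperFun n m k := fun p =>
  if h : Even z.parity then
    ∑ j, (fderiv ℝ (fun q => (Module.finBasis ℝ (Grassmann n m k)).repr (f q) j) p
      (Pi.single (⟨z, h⟩ : EvenCoord n m k) (1 : ℝ))) • Module.finBasis ℝ (Grassmann n m k) j
  else CliffordAlgebra.contractLeft
    (LinearMap.proj (⟨z, h⟩ : OddCoord n m k) : (OddCoord n m k → ℝ) →ₗ[ℝ] ℝ) (f p)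

/-- `twist r F = (-1)^{r ε(F)} F`, extended linearly to inhomogeneous `F`. -/
def twist (r : ℕ) (f : SuperFun n m k) : SuperFun n m k := fun p =>
  (CliffordAlgebra.involute)^[r] (f p)

/-- The canonical even Poisson bracket on `Π T 𝒩`,
`{F,G} = ∑_A (-1)^{A(F+1)} (∂F/∂dφ*_A ∂G/∂φ^A + (-1)^F ∂F/∂dφ^A ∂G/∂φ*_A)
  - (-1)^{AF} (∂F/∂φ^A ∂G/∂dφ*_A - (-1)^F ∂F/∂φ*_A ∂G/∂dφ^A)`. -/
def bracket (f g : SuperFun n m k) : SuperFun n m k :=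
  ∑ A : Idx n m k,
    ((-1 : ℝ) ^ A.parity • (pd (dmom A) (twist A.parity f) * pd (fld A) g
        + pd (dfld A) (twist (A.parity + 1) f) * pd (mom A) g)
      - (pd (fld A) (twist A.parity f) * pd (dmom A) g
        - pd (mom A) (twist (A.parity + 1) f) * pd (dfld A) g))

/-- The canonical odd function `Δ = ∑_A (-1)^A dφ^A dφ*_A`. -/
def canonicalDelta : SuperFun n m k :=
  ∑ A : Idx n m k, (-1 : ℝ) ^ A.parity • (coord (dfld A) * coord (dmom A))

/-- Restriction to the locus where the coordinates selected by `s` vanish, regarded as a function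
of all coordinates which does not depend on the selected ones. -/
def restrict (s : Coordinate n m k → Bool) (f : SuperFun n m k) : SuperFun n m k := fun p =>
  ExteriorAlgebra.map
    (LinearMap.pi fun z : OddCoord n m k => if s z.1 then 0 else LinearMap.proj z)
    (f fun z => if s z.1 then 0 else p z)

/-- Restriction to `ℒ = {φ* = 0 = dφ*}`. -/
def restrictL (f : SuperFun n m k) : SuperFun n m k := restrict (fun z => z.1.2) f

/-- Restriction to `𝒩 = {dφ = 0 = dφ*}`. -/
def restrictN (f : SuperFun n m k) : SuperFun n m k := restrict (fun z => z.1.1) f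

/-- Restriction to the locus `{φ* = 0}`; on functions on `𝒩`, the restriction to `ℳ`. -/
def restrictM (f : SuperFun n m k) : SuperFun n m k := restrict (fun z => !z.1.1 && z.1.2) f

/-- The odd bracket generated by `Δ`: `(F,G) = {{Δ,F},G}|_𝒩`. -/
def oddBracket (f g : SuperFun n m k) : SuperFun n m k :=
  restrictN (bracket (bracket canonicalDelta f) g)

/-- The component `∑_A φ*_A (∂F/∂φ*_A)|_{φ* = 0}` of momentum degree one. -/
def linearPart (f : SuperFun n m k) : SuperFun n m k :=
  ∑ A : Idx n m k, coord (mom A) * restrictM (pd (mom A) f)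

/-- `Q F = (S¹, F)`. -/
def brst (S f : SuperFun n m k) : SuperFun n m k := oddBracket (linearPart S) f

/-- `Q̂ w = {Ψ, w}|_ℒ` with `Ψ = {Δ, S}`. -/
def liftedBrst (S w : SuperFun n m k) : SuperFun n m k :=
  restrictL (bracket (bracket canonicalDelta S) w)

/-- The interior product `ι_X w = (-1)^X {X, w}|_ℒ`. -/
def interior (X w : SuperFun n m k) : SuperFun n m k := restrictL (bracket (twist 1 X) w)

/-- The exterior differential `d w = {Δ, w}|_ℒ`. -/
def extDiff (w : SuperFun n m k) : SuperFun n m k := restrictL (bracket canonicalDelta w)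

/-- The time derivative `ẇ = {Γ, w}|_ℒ` with `Γ = {Δ, V}`. -/
def timeDeriv (V w : SuperFun n m k) : SuperFun n m k :=
  restrictL (bracket (bracket canonicalDelta V) w)

/-- The Lie derivative along `V`, as the graded commutator
`d ∘ ι_V - (-1)^V ι_V ∘ d` of the exterior differential and the interior product; here `(-1)^V`
refers to the parity of the function `V` on `𝒩`, which is opposite to that of the corresponding
vector field (so this is `d ∘ ι_V + ι_V ∘ d` for odd `V`). -/
def lieDeriv (V w : SuperFun n m k) : SuperFun n m k :=
  extDiff (interior V w) - interior (twist 1 V) (extDiff w)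

end Local

/-! ### Algebras of smooth superfunctions -/

section Algebra

variable {n m k : ℕ}

theorem smoothOn_iff (W : Set (Body n m k)) (f : SuperFun n m k) :
    SmoothOn W f ↔ ∀ j, ContDiffOn ℝ ∞
      (fun p => (Module.finBasis ℝ (Grassmann n m k)).repr (f p) j) W := by
  refine ⟨fun h j => h ((Module.finBasis ℝ (Grassmann n m k)).coord j), fun h l => ?_⟩
  have e : (fun p => l (f p)) = fun p => ∑ j,
      (Module.finBasis ℝ (Grassmann n m k)).repr (f p) j *
        l (Module.finBasis ℝ (Grassmann n m k) j) := by
    funext p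
    conv_lhs => rw [← (Module.finBasis ℝ (Grassmann n m k)).sum_repr (f p)]
    simp only [map_sum, map_smul, smul_eq_mul]
  rw [e]
  exact ContDiffOn.sum fun j _ => (h j).mul contDiffOn_const

/-- The superfunctions which are smooth on `W`, with no condition on their values off `W`. -/
def smoothSubalgebra (W : Set (Body n m k)) : Subalgebra ℝ (SuperFun n m k) where
  carrier := {f | SmoothOn W f}
  mul_mem' := by
    intro f g hf hg l
    have e : (fun p => l ((f * g) p)) = fun p => ∑ j,
        (Module.finBasis ℝ (Grassmann n m k)).repr (f p) j *
          (l ∘ₗ LinearMap.mulLeft ℝ (Module.finBasis ℝ (Grassmann n m k) j)) (g p) := by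
      funext p
      rw [Pi.mul_apply]
      conv_lhs => rw [← (Module.finBasis ℝ (Grassmann n m k)).sum_repr (f p)]
      simp only [Finset.sum_mul, map_sum, map_smul, smul_eq_mul, smul_mul_assoc,
        LinearMap.comp_apply, LinearMap.mulLeft_apply]
    rw [e]
    exact ContDiffOn.sum fun j _ => ((smoothOn_iff W f).1 hf j).mul (hg _)
  add_mem' := by
    intro f g hf hg l
    simpa using (hf l).add (hg l)
  algebraMap_mem' := by
    intro r l
    exact contDiffOn_const (c := l (algebraMap ℝ (Grassmann n m k) r))

/-- The algebra of smooth functions on the superdomain with underlying open set `W`. -/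
def smoothFunctions (W : Set (Body n m k)) : Subalgebra ℝ (W → Grassmann n m k) :=
  (smoothSubalgebra W).map
    (AlgHom.pi
      fun p : W => Pi.evalAlgHom ℝ (fun _ : Body n m k => Grassmann n m k) p.1)

/-- The smooth function on the superdomain over `W` defined by `f`. -/
def toSmooth (W : Set (Body n m k)) (f : SuperFun n m k) (hf : SmoothOn W f) :
    smoothFunctions W := ⟨fun p => f p.1, f, hf, rfl⟩

theorem smoothOn_coord (W : Set (Body n m k)) (z : Coordinate n m k) :
    SmoothOn W (coord z) := by
  intro l
  unfold coord
  split_ifs with h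
  · have e : (fun p : Body n m k => l (algebraMap ℝ (Grassmann n m k) (p ⟨z, h⟩))) =
        fun p => p ⟨z, h⟩ * l 1 := by
      funext p
      rw [Algebra.algebraMap_eq_smul_one, map_smul, smul_eq_mul]
    rw [e]
    exact ((contDiff_apply ℝ ℝ (⟨z, h⟩ : EvenCoord n m k)).contDiffOn).mul contDiffOn_const
  · exact contDiffOn_const

end Algebra

/-! ### Global functions -/

section Global

variable {n m k : ℕ} {M : Type*} [TopologicalSpace M]
  [ChartedSpace (EuclideanSpace ℝ (Fin n)) M]
  (E : M → Type*) [∀ x, TopologicalSpace (E x)] [TopologicalSpace (TotalSpace (Fin m → ℝ) E)]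
  [FiberBundle (Fin m → ℝ) E]
  (F : M → Type*) [∀ x, TopologicalSpace (F x)] [TopologicalSpace (TotalSpace (Fin k → ℝ) F)]
  [FiberBundle (Fin k → ℝ) F]

/-- A local coordinate system on `ℳ`: a smooth chart of `M` and local trivializations of `E`
and `F`. -/
structure CoordSystem where
  chart : OpenPartialHomeomorph M (EuclideanSpace ℝ (Fin n))
  chart_mem : chart ∈ IsManifold.maximalAtlas (𝓡 n) ∞ M
  trivE : Trivialization (Fin m → ℝ) (TotalSpace.proj : TotalSpace (Fin m → ℝ) E → M)
  trivE_mem : MemTrivializationAtlas trivE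
  trivF : Trivialization (Fin k → ℝ) (TotalSpace.proj : TotalSpace (Fin k → ℝ) F → M)
  trivF_mem : MemTrivializationAtlas trivF

/-- The coordinates `(x^i)` of a point of the body. -/
def xPart (p : Body n m k) : EuclideanSpace ℝ (Fin n) :=
  WithLp.toLp 2 fun i => p ⟨fld (Idx.x i), ⟨0, rfl⟩⟩

namespace CoordSystem

variable {E F}

/-- The open subset of `M` on which the coordinate system is defined. -/
def base (c : CoordSystem (n := n) (m := m) (k := k) E F) : Set M :=
  c.chart.source ∩ (c.trivE.baseSet ∩ c.trivF.baseSet)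

/-- The point of `M` with the given coordinates. -/
def point (c : CoordSystem (n := n) (m := m) (k := k) E F) (p : Body n m k) : M :=
  c.chart.symm (xPart p)

/-- The part of `Π T 𝒩` over the common domain of `c` and `c'`, in the coordinates of `c`. -/
def overlap (c c' : CoordSystem (n := n) (m := m) (k := k) E F) : Set (Body n m k) :=
  {p | xPart p ∈ c.chart.target ∧ c.point p ∈ c.base ∩ c'.base}

/-- The part of `Π T 𝒩` over the domain of `c`, in the coordinates of `c`. -/
def domain (c : CoordSystem (n := n) (m := m) (k := k) E F) : Set (Body n m k) :=
  {p | xPart p ∈ c.chart.target ∧ c.point p ∈ c.base}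

theorem overlap_subset (c c' : CoordSystem (n := n) (m := m) (k := k) E F) :
    overlap c c' ⊆ c.domain := fun _ hp => ⟨hp.1, hp.2.1⟩

/-- `ψ` expresses the coordinates of `c'` on `Π T 𝒩` through those of `c`. The coordinates `η`
and `c` change like the fibre coordinates of `E` and `F`, the momenta by
`φ*_A = ∑_B (∂φ'^B/∂φ^A) φ*'_B`, and the velocities so that `(-1)^z dz = {Δ, z}` for
`z = φ^A, φ*_A`. -/
structure IsTransition (c c' : CoordSystem (n := n) (m := m) (k := k) E F)
    (ψ : Coordinate n m k → SuperFun n m k) : Prop where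
  smooth : ∀ z, SmoothOn (overlap c c') (ψ z)
  x_eq : ∀ i, ∀ p ∈ overlap c c',
    ψ (fld (Idx.x i)) p = algebraMap ℝ (Grassmann n m k) (c'.chart (c.point p) i)
  eta_eq : ∀ a, ∀ p ∈ overlap c c',
    ψ (fld (Idx.eta a)) p =
      ∑ b, c.trivE.coordChange c'.trivE (c.point p) (Pi.single b 1) a • coord (fld (Idx.eta b)) p
  c_eq : ∀ a, ∀ p ∈ overlap c c',
    ψ (fld (Idx.c a)) p =
      ∑ b, c.trivF.coordChange c'.trivF (c.point p) (Pi.single b 1) a • coord (fld (Idx.c b)) p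
  mom_eq : ∀ A, ∀ p ∈ overlap c c',
    coord (mom A) p = ∑ B, pd (fld A) (ψ (fld B)) p * ψ (mom B) p
  dfld_eq : ∀ A, ∀ p ∈ overlap c c',
    (-1 : ℝ) ^ (fld A).parity • ψ (dfld A) p = bracket canonicalDelta (ψ (fld A)) p
  dmom_eq : ∀ A, ∀ p ∈ overlap c c',
    (-1 : ℝ) ^ (mom A).parity • ψ (dmom A) p = bracket canonicalDelta (ψ (mom A)) p

/-- The algebra homomorphism `Φ` is the change of coordinates on `Π T 𝒩` from `c'` to `c`; as
a homomorphism between algebras of smooth functions on superdomains it is determined by the images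
of the coordinates. -/
def IsCoordinateChange (c c' : CoordSystem (n := n) (m := m) (k := k) E F)
    (Φ : smoothFunctions (overlap c' c) →ₐ[ℝ] smoothFunctions (overlap c c')) : Prop :=
  ∃ (ψ : Coordinate n m k → SuperFun n m k) (hψ : IsTransition c c' ψ),
    ∀ z : Coordinate n m k,
      Φ (toSmooth _ (coord z) (smoothOn_coord _ z)) = toSmooth _ (ψ z) (hψ.smooth z)

end CoordSystem

/-- Families of local expressions, one for each coordinate system. -/
abbrev LocalFamily : Type _ :=
  CoordSystem (n := n) (m := m) (k := k) E F → SuperFun n m k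

variable {E F}

/-- The family consists of the local expressions of a smooth function on `Π T 𝒩`: each of them is
smooth on the coordinate domain, and they correspond to each other under changes of
coordinates. -/
structure IsGlobal (f : LocalFamily (n := n) (m := m) (k := k) E F) : Prop where
  smooth : ∀ c, SmoothOn c.domain (f c)
  compatible : ∀ c c',
    ∃ Φ : smoothFunctions (CoordSystem.overlap c' c) →ₐ[ℝ]
        smoothFunctions (CoordSystem.overlap c c'),
      CoordSystem.IsCoordinateChange c c' Φ ∧
      Φ (toSmooth _ (f c') fun l => (smooth c' l).mono (CoordSystem.overlap_subset c' c)) =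
        toSmooth _ (f c) fun l => (smooth c l).mono (CoordSystem.overlap_subset c c')

/-- `f` is homogeneous of Grassmann parity `r` (modulo two). -/
def HasParity (r : ℕ) (f : LocalFamily (n := n) (m := m) (k := k) E F) : Prop :=
  ∀ c, Set.EqOn (twist 1 (f c)) ((-1 : ℝ) ^ r • f c) c.domain

/-- `f` is homogeneous of ghost number `g`: an eigenfunction of the Euler vector field. -/
def HasGhost (g : ℤ) (f : LocalFamily (n := n) (m := m) (k := k) E F) : Prop :=
  ∀ c, Set.EqOn (∑ z : Coordinate n m k, (z.ghost : ℝ) • (coord z * pd z (f c)))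
    ((g : ℝ) • f c) c.domain

/-- A smooth function on `𝒩`, regarded as a function on `Π T 𝒩`. -/
def IsFunctionOnN (f : LocalFamily (n := n) (m := m) (k := k) E F) : Prop :=
  IsGlobal f ∧ ∀ c, Set.EqOn (restrictN (f c)) (f c) c.domain

/-- A smooth function on `ℒ`, that is, a differential form on `ℳ`. -/
def IsFunctionOnL (f : LocalFamily (n := n) (m := m) (k := k) E F) : Prop :=
  IsGlobal f ∧ ∀ c, Set.EqOn (restrictL (f c)) (f c) c.domain

/-- `Deg f > 0`: no component of momentum degree zero. -/
def HasPositiveDeg (f : LocalFamily (n := n) (m := m) (k := k) E F) : Prop :=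
  ∀ c, Set.EqOn (restrictM (f c)) 0 c.domain

/-- `Deg f = 1`, that is, `f = X^A(φ) φ*_A` for a function `f` on `𝒩`. -/
def HasDegOne (f : LocalFamily (n := n) (m := m) (k := k) E F) : Prop :=
  ∀ c, Set.EqOn (∑ A : Idx n m k, coord (mom A) * pd (mom A) (f c)) (f c) c.domain

/-- A master function: `ε(S) = 0`, `gh(S) = 2`, `Deg(S) > 0` and `(S,S) = 0`. Its terms which
contain neither `η` nor `c*` are `T^a η*_a + c^α R^i_α x*_i + P^{ij} x*_j x*_i`, with the constraints
`T`, the gauge generators `R` and the bivector `P`. No rank condition is imposed on them. -/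
structure IsMasterFunction (S : LocalFamily (n := n) (m := m) (k := k) E F) : Prop where
  onN : IsFunctionOnN S
  parity : HasParity 0 S
  ghost : HasGhost 2 S
  deg : HasPositiveDeg S
  master : ∀ c, Set.EqOn (oddBracket (S c) (S c)) 0 c.domain

/-- A projectible vector field, as a vector field `X^A(φ) φ*_A` on `ℳ` which is a
`Q`-cocycle. -/
structure IsProjectibleVectorField (S X : LocalFamily (n := n) (m := m) (k := k) E F) :
    Prop where
  onN : IsFunctionOnN X
  deg : HasDegOne X
  cocycle : ∀ c, Set.EqOn (brst (S c) (X c)) 0 c.domain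

/-- A weak Poisson vector field, as a function on `𝒩` of positive momentum degree with
`(S,V) = 0`. -/
structure IsWeakPoissonVectorField (S V : LocalFamily (n := n) (m := m) (k := k) E F) :
    Prop where
  onN : IsFunctionOnN V
  deg : HasPositiveDeg V
  master : ∀ c, Set.EqOn (oddBracket (S c) (V c)) 0 c.domain

/-- A projectible differential form: a function on `ℒ` which is a `Q̂`-cocycle. -/
structure IsProjectibleForm (S w : LocalFamily (n := n) (m := m) (k := k) E F) : Prop where
  onL : IsFunctionOnL w
  cocycle : ∀ c, Set.EqOn (liftedBrst (S c) (w c)) 0 c.domain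

end Global

end WeakKoszul

end

/-! Both formulas are instances of the graded Jacobi identity for the even bracket on `Π T 𝒩`, once
the intermediate restrictions are removed. Put `Γ = {Δ,V}`, which is even.

On `ℒ` the functions `Δ`, `V` and `X` vanish: each term of `Δ` has a factor `dφ*`, and `V` and `X`
have positive momentum degree. Hence `Γ` vanishes there too. `ℒ` is Lagrangian: it kills exactly one
coordinate of every conjugate pair. So if `f` vanishes on `ℒ`, the bracket `{f,g}` restricted to `ℒ`
only sees derivatives of `g` along `ℒ`, and `g` may be replaced by its restriction (`pb_restrict`).
Nested expressions such as `{Γ,{X,ω}|_ℒ}|_ℒ` thus become honest double brackets.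

The other restriction is the one in `(V,X) = {{Δ,V},X}|_𝒩`. It changes nothing: `Δ` is quadratic in
the velocities with constant coefficients, and `V`, `X` do not depend on them, so each bracket uses
up one velocity (`derived_fixed`).

The first formula is then `{Γ,{X,ω}} = {{Γ,X},ω} + {X,{Γ,ω}}`, multiplied by `(-1)^X`. Jacobi for
the odd pair `Δ`, `V` gives Cartan's formula `ℒ_V ω = -{Γ,ω}|_ℒ`, so the second formula is minus the
first.

All of this is proved in an abstract supercommutative algebra with graded commuting derivations. It
remains to check that smooth superfunctions over a coordinate domain form such an algebra and that
the concrete operations correspond to the abstract ones. -/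

noncomputable section

/-! ### Abstract even Poisson brackets and the graded Jacobi identity. -/

namespace WeakKoszul

/-- A supercommutative algebra with commuting graded derivations `D z`, paired by an involution of
the index set, and the constants of the corresponding even Poisson bracket. -/
structure DiffSuperalgebra (Z R : Type*) [Ring R] [Algebra ℝ R] where
  par : Z → ℕ
  invol : R →ₐ[ℝ] R
  D : Z → R →ₗ[ℝ] R
  D_mul : ∀ z f g, D z (f * g) = D z f * g + (⇑invol)^[par z] f * D z g
  invol_D : ∀ z f, invol (D z f) = (-1 : ℝ) ^ par z • D z (invol f)
  D_comm : ∀ z w f, D z (D w f) = (-1 : ℝ) ^ (par z * par w) • D w (D z f)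
  supercomm : ∀ (a b : ℕ) (f g : R), invol f = (-1 : ℝ) ^ a • f → invol g = (-1 : ℝ) ^ b • g →
    f * g = (-1 : ℝ) ^ (a * b) • (g * f)
  conj : Z → Z
  conj_conj : ∀ z, conj (conj z) = z
  par_conj : ∀ z, par (conj z) = par z
  κ : Z → ℝ
  κ_conj : ∀ z, κ (conj z) = -(-1 : ℝ) ^ par z * κ z

namespace DiffSuperalgebra

variable {Z R : Type*} [Ring R] [Algebra ℝ R] (C : DiffSuperalgebra Z R)

/-- `f` is homogeneous of parity `a`. -/
def Homogeneous (a : ℕ) (f : R) : Prop := C.invol f = (-1 : ℝ) ^ a • f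

variable {C}

theorem Homogeneous.iterate {a : ℕ} {f : R} (hf : C.Homogeneous a f) (r : ℕ) :
    (⇑C.invol)^[r] f = (-1 : ℝ) ^ (a * r) • f := by
  induction r with
  | zero => simp
  | succ r ih =>
    rw [Function.iterate_succ_apply', ih, map_smul, hf, smul_smul, ← pow_add, mul_add, mul_one]

theorem Homogeneous.D {a : ℕ} {f : R} (hf : C.Homogeneous a f) (z : Z) :
    C.Homogeneous (a + C.par z) (C.D z f) := by
  unfold Homogeneous at *
  rw [C.invol_D, hf, map_smul, smul_smul, ← pow_add, add_comm]

theorem Homogeneous.mul {a b : ℕ} {f g : R} (hf : C.Homogeneous a f) (hg : C.Homogeneous b g) :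
    C.Homogeneous (a + b) (f * g) := by
  unfold Homogeneous at *
  rw [map_mul, hf, hg, smul_mul_smul_comm, ← pow_add]

theorem Homogeneous.smul {a : ℕ} {f : R} (hf : C.Homogeneous a f) (r : ℝ) :
    C.Homogeneous a (r • f) := by
  unfold Homogeneous at *
  rw [map_smul, hf, smul_comm]

theorem Homogeneous.sum {ι : Type*} {a : ℕ} {f : ι → R} (s : Finset ι)
    (hf : ∀ i ∈ s, C.Homogeneous a (f i)) : C.Homogeneous a (∑ i ∈ s, f i) := by
  unfold Homogeneous at *
  rw [map_sum, Finset.smul_sum]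
  exact Finset.sum_congr rfl hf

theorem Homogeneous.congr {a b : ℕ} {f : R} (hf : C.Homogeneous a f)
    (h : (-1 : ℝ) ^ a = (-1 : ℝ) ^ b) : C.Homogeneous b f := by
  unfold Homogeneous at *
  rw [hf, h]

theorem iterate_invol_smul (r : ℕ) (t : ℝ) (f : R) :
    (⇑C.invol)^[r] (t • f) = t • (⇑C.invol)^[r] f := by
  induction r with
  | zero => rfl
  | succ r ih => rw [Function.iterate_succ_apply', ih, map_smul, Function.iterate_succ_apply']

theorem iterate_invol_commute {ρ : R →ₐ[ℝ] R} (hσ : ∀ f, ρ (C.invol f) = C.invol (ρ f)) (r : ℕ) (f : R) :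
    ρ ((⇑C.invol)^[r] f) = (⇑C.invol)^[r] (ρ f) := by
  induction r with
  | zero => rfl
  | succ r ih => rw [Function.iterate_succ_apply', hσ, ih, Function.iterate_succ_apply']

variable [Fintype Z] (C)

/-- The even Poisson bracket. -/
def pb (f g : R) : R :=
  ∑ z, C.κ z • (C.D z ((⇑C.invol)^[C.par z] f) * C.D (C.conj z) g)

variable {C}

theorem Homogeneous.pb_eq {a : ℕ} {f : R} (hf : C.Homogeneous a f) (g : R) :
    C.pb f g = ∑ z, (C.κ z * (-1 : ℝ) ^ (a * C.par z)) • (C.D z f * C.D (C.conj z) g) := by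
  refine Finset.sum_congr rfl fun z _ => ?_
  rw [hf.iterate, map_smul, smul_mul_assoc, smul_smul]

theorem pb_smul_left (t : ℝ) (f g : R) : C.pb (t • f) g = t • C.pb f g := by
  simp only [pb, iterate_invol_smul, map_smul, smul_mul_assoc, Finset.smul_sum, smul_comm t]

theorem pb_smul_right (t : ℝ) (f g : R) : C.pb f (t • g) = t • C.pb f g := by
  simp only [pb, map_smul, mul_smul_comm, Finset.smul_sum, smul_comm t]

theorem pb_zero_right (f : R) : C.pb f 0 = 0 := by
  simp only [pb, map_zero, mul_zero, smul_zero, Finset.sum_const_zero]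

/-- Conjugate derivations have equal parity, so the two derivatives in each term shift the parity by
an even amount. -/
theorem Homogeneous.pb {a b : ℕ} {f g : R} (hf : C.Homogeneous a f) (hg : C.Homogeneous b g) :
    C.Homogeneous (a + b) (C.pb f g) := by
  rw [hf.pb_eq]
  refine Homogeneous.sum _ fun z _ => Homogeneous.smul (((hf.D z).mul (hg.D _)).congr ?_) _
  rw [C.par_conj]
  rcases Nat.even_or_odd (C.par z) with h | h <;> simp [pow_add, h.neg_one_pow]

/-- The coordinate derivations are derivations of the bracket. -/
theorem D_pb {a : ℕ} {f : R} (hf : C.Homogeneous a f) (w : Z) (g : R) :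
    C.D w (C.pb f g) = C.pb (C.D w f) g + (-1 : ℝ) ^ (a * C.par w) • C.pb f (C.D w g) := by
  rw [hf.pb_eq, (hf.D w).pb_eq, hf.pb_eq, map_sum, Finset.smul_sum, ← Finset.sum_add_distrib]
  refine Finset.sum_congr rfl fun z _ => ?_
  rw [map_smul, C.D_mul, (hf.D z).iterate, C.D_comm w z f, C.D_comm w (C.conj z) g, C.par_conj]
  simp only [smul_add, smul_mul_assoc, mul_smul_comm, smul_smul]
  congr 2 <;>
  · rcases Nat.even_or_odd (C.par z) with h | h <;>
    rcases Nat.even_or_odd (C.par w) with h' | h' <;>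
    simp [pow_add, pow_mul, add_mul, mul_add, mul_comm, h.neg_one_pow,
      h'.neg_one_pow]

theorem smul_congr_sign {x : R} {s t : ℝ} {i j : ℕ} (hst : s = t) (h : Even i ↔ Even j) :
    (s * (-1 : ℝ) ^ i) • x = (t * (-1 : ℝ) ^ j) • x := by
  rw [hst, neg_one_pow_congr h]

/-- Here `w` runs over the inner bracket and `z` over the outer one. The Leibniz rule splits the
result by whether the second derivative falls on `g` or on `h`; Jacobi is proved by matching these
sums. -/
theorem pb_pb_right {a b : ℕ} {f g : R} (hf : C.Homogeneous a f) (hg : C.Homogeneous b g) (h : R) :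
    C.pb f (C.pb g h) =
      (∑ w, ∑ z, (C.κ w * C.κ z * (-1 : ℝ) ^ (a * C.par z + b * C.par w)) •
        (C.D z f * C.D (C.conj z) (C.D w g) * C.D (C.conj w) h)) +
      ∑ w, ∑ z, (C.κ w * C.κ z * (-1 : ℝ) ^
          (a * C.par z + b * C.par w + (b + C.par w) * C.par z)) •
        (C.D z f * C.D w g * C.D (C.conj z) (C.D (C.conj w) h)) := by
  rw [hf.pb_eq, hg.pb_eq]
  simp only [map_sum, Finset.mul_sum, Finset.smul_sum]
  rw [Finset.sum_comm, ← Finset.sum_add_distrib]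
  refine Finset.sum_congr rfl fun w _ => ?_
  rw [← Finset.sum_add_distrib]
  refine Finset.sum_congr rfl fun z _ => ?_
  rw [map_smul, C.D_mul, (hg.D w).iterate, C.par_conj]
  simp only [smul_add, mul_add, smul_mul_assoc, mul_smul_comm, smul_smul, mul_assoc]
  congr 2 <;> ring

/-- Here `w` runs over the outer bracket and `z` over the inner one; the second derivative falls on
`f` in the first sum and on `g` in the second. -/
theorem pb_pb_left {a b : ℕ} {f g : R} (hf : C.Homogeneous a f) (hg : C.Homogeneous b g) (h : R) :
    C.pb (C.pb f g) h =
      (∑ w, ∑ z, (C.κ w * C.κ z * (-1 : ℝ) ^ ((a + b) * C.par w + a * C.par z)) •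
        (C.D w (C.D z f) * C.D (C.conj z) g * C.D (C.conj w) h)) +
      ∑ w, ∑ z, (C.κ w * C.κ z * (-1 : ℝ) ^
          ((a + b) * C.par w + a * C.par z + (a + C.par z) * C.par w)) •
        (C.D z f * C.D w (C.D (C.conj z) g) * C.D (C.conj w) h) := by
  rw [(hf.pb hg).pb_eq, hf.pb_eq]
  simp only [map_sum, Finset.sum_mul, Finset.smul_sum]
  rw [← Finset.sum_add_distrib]
  refine Finset.sum_congr rfl fun w _ => ?_
  rw [← Finset.sum_add_distrib]
  refine Finset.sum_congr rfl fun z _ => ?_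
  rw [map_smul, C.D_mul, (hf.D z).iterate]
  simp only [smul_add, add_mul, smul_mul_assoc, smul_smul, mul_assoc]
  congr 2 <;> ring

/-- The graded Jacobi identity. -/
theorem jacobi {a b : ℕ} {f g : R} (hf : C.Homogeneous a f) (hg : C.Homogeneous b g) (h : R) :
    C.pb f (C.pb g h) = C.pb (C.pb f g) h + (-1 : ℝ) ^ (a * b) • C.pb g (C.pb f h) := by
  rw [pb_pb_right hf hg, pb_pb_left hf hg, pb_pb_right hg hf]
  -- The six sums pair off by the function that is differentiated twice: `g` gives `F₁ = L₂`, `h`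
  -- gives `T₁ = s • T₂`, and `f` gives `L₁ = -(s • F₂)`.
  have combine : ∀ (s : ℝ) (F₁ T₁ L₁ L₂ F₂ T₂ : R), F₁ = L₂ → T₁ = s • T₂ → L₁ = -(s • F₂) →
      F₁ + T₁ = L₁ + L₂ + s • (F₂ + T₂) := by
    rintro s _ _ _ F₁ F₂ T₂ rfl rfl rfl
    rw [smul_add]
    abel
  refine combine _ _ _ _ _ _ _ ?_ ?_ ?_
  · refine Finset.sum_congr rfl fun w _ => Finset.sum_congr rfl fun z _ => ?_
    rw [C.D_comm w (C.conj z), mul_smul_comm, smul_mul_assoc, smul_smul, mul_assoc (_ * _),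
      ← pow_add, C.par_conj]
    refine smul_congr_sign rfl ?_
    simp only [Nat.even_add, Nat.even_mul]
    tauto
  -- Second derivatives of `h`: exchanging `f` and `g` exchanges the roles of `z` and `w`, so the
  -- order of summation is swapped.
  · rw [Finset.sum_comm]
    simp only [Finset.smul_sum]
    refine Finset.sum_congr rfl fun z _ => Finset.sum_congr rfl fun w _ => ?_
    rw [C.supercomm _ _ _ _ (hf.D z) (hg.D w), C.D_comm (C.conj z), C.par_conj, C.par_conj]
    simp only [smul_mul_assoc, mul_smul_comm, smul_smul]
    rw [mul_assoc (_ * _), ← pow_add, ← pow_add, mul_left_comm ((-1 : ℝ) ^ (a * b)), ← pow_add]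
    refine smul_congr_sign (mul_comm _ _) ?_
    by_cases ha : Even a <;> by_cases hb : Even b <;> by_cases hz : Even (C.par z) <;>
      by_cases hw : Even (C.par w) <;> simp [Nat.even_add, Nat.even_mul, ha, hb, hz, hw]
  -- Second derivatives of `f`: reindexing the inner sum by `conj` brings in `κ_conj`, the graded
  -- skew-symmetry of the bracket, which supplies the minus sign.
  · rw [Finset.smul_sum, ← Finset.sum_neg_distrib]
    refine Finset.sum_congr rfl fun w _ => ?_
    rw [Finset.smul_sum, ← Finset.sum_neg_distrib]
    refine Fintype.sum_equiv ⟨C.conj, C.conj, C.conj_conj, C.conj_conj⟩ _ _ fun z => ?_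
    simp only [Equiv.coe_fn_mk, C.conj_conj, C.par_conj, C.κ_conj]
    rw [C.supercomm _ _ _ _ ((hf.D z).D w) (hg.D (C.conj z)), C.D_comm w z, C.par_conj]
    simp only [smul_mul_assoc, mul_smul_comm, smul_smul]
    rw [← neg_smul]
    trans (C.κ w * C.κ z * (-1 : ℝ) ^ ((a + b) * C.par w + a * C.par z +
      (a + C.par z + C.par w) * (b + C.par z) + C.par w * C.par z)) •
        (C.D (C.conj z) g * C.D z (C.D w f) * C.D (C.conj w) h)
    · congr 1
      ring
    trans (C.κ w * C.κ z * (-1 : ℝ) ^ (a * b + C.par z + b * C.par z + a * C.par w)) •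
        (C.D (C.conj z) g * C.D z (C.D w f) * C.D (C.conj w) h)
    · refine smul_congr_sign rfl ?_
      by_cases ha : Even a <;> by_cases hb : Even b <;> by_cases hz : Even (C.par z) <;>
        by_cases hw : Even (C.par w) <;> simp [Nat.even_add, Nat.even_mul, ha, hb, hz, hw]
    · congr 1
      ring

/-! ### Lagrangian restrictions and derived brackets. -/

section Restriction

variable {s : Z → Bool} {ρ : R →ₐ[ℝ] R}

/-- A Lagrangian restriction `ρ`: it sets to zero the coordinates selected by `s`, one in each
conjugate pair. -/
structure IsLagrangianRestriction (C : DiffSuperalgebra Z R) (s : Z → Bool) (ρ : R →ₐ[ℝ] R) :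
    Prop where
  conj : ∀ z, s (C.conj z) = !s z
  idem : ∀ f, ρ (ρ f) = ρ f
  invol : ∀ f, ρ (C.invol f) = C.invol (ρ f)
  D_tangent : ∀ z, s z = false → ∀ f, C.D z (ρ f) = ρ (C.D z f)
  D_normal : ∀ z, s z = true → ∀ f, C.D z (ρ f) = 0

namespace IsLagrangianRestriction

/-- If `f` vanishes on a Lagrangian submanifold, then the restriction of `{f, g}` to it depends
only on the restriction of `g`. -/
theorem pb_restrict (hρ : IsLagrangianRestriction C s ρ) {f : R} (hf : ρ f = 0) (g : R) :
    ρ (C.pb f (ρ g)) = ρ (C.pb f g) := by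
  simp only [pb, map_sum, map_smul, map_mul]
  refine Finset.sum_congr rfl fun z _ => ?_
  -- For tangent `z` the factor `D z f` restricts to zero because `f` does. For normal `z` the
  -- conjugate direction is tangent, so `D (conj z)` commutes with `ρ`.
  cases hz : s z with
  | false =>
    rw [← hρ.D_tangent z hz, iterate_invol_commute hρ.invol, hf]
    simp [Function.iterate_fixed (map_zero C.invol)]
  | true =>
    rw [hρ.D_tangent (C.conj z) (by rw [hρ.conj, hz]; rfl), hρ.idem]

theorem pb_eq_zero (hρ : IsLagrangianRestriction C s ρ) {f g : R} (hf : ρ f = 0) (hg : ρ g = 0) :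
    ρ (C.pb f g) = 0 := by
  rw [← hρ.pb_restrict hf, hg, pb_zero_right, map_zero]

/-- If `f` is affine in the normal coordinates and `g` does not depend on them, neither does
`{f, g}`. -/
theorem pb_fixed (hρ : IsLagrangianRestriction C s ρ) {a : ℕ} {f g : R} (hf : C.Homogeneous a f)
    (hDf : ∀ z, s z = true → ρ (C.D z f) = C.D z f) (hg : ρ g = g) :
    ρ (C.pb f g) = C.pb f g := by
  rw [hf.pb_eq]
  simp only [map_sum, map_smul, map_mul]
  refine Finset.sum_congr rfl fun z _ => ?_
  cases hz : s z with
  | false =>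
    have : C.D (C.conj z) g = 0 := by
      rw [← hg]
      exact hρ.D_normal _ (by rw [hρ.conj, hz]; rfl) _
    simp [this]
  | true =>
    have h : ρ (C.D (C.conj z) g) = C.D (C.conj z) g := by
      rw [← hρ.D_tangent (C.conj z) (by rw [hρ.conj, hz]; rfl), hg]
    rw [hDf z hz, h]

/-- The derived bracket of two functions of the tangent coordinates is again such a function. -/
theorem derived_fixed (hρ : IsLagrangianRestriction C s ρ) {a b : ℕ} {Δ f g : R}
    (hΔ : C.Homogeneous a Δ)
    (hD : ∀ z w, s z = true → s w = true → ρ (C.D z (C.D w Δ)) = C.D z (C.D w Δ))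
    (hf : C.Homogeneous b f) (hfN : ρ f = f) (hgN : ρ g = g) :
    ρ (C.pb (C.pb Δ f) g) = C.pb (C.pb Δ f) g := by
  refine hρ.pb_fixed (hΔ.pb hf) (fun w hw => ?_) hgN
  have h0 : C.D w f = 0 := by
    rw [← hfN]
    exact hρ.D_normal w hw f
  -- As `f` does not depend on the normal coordinates, `D w {Δ,f} = {D w Δ, f}`. The same criterion
  -- applies to this bracket, now with the second normal derivatives of `Δ` as input.
  rw [D_pb hΔ, h0, pb_zero_right, smul_zero, add_zero]
  exact hρ.pb_fixed (hΔ.D w) (fun z hz => hD z w hz hw) hfN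

end IsLagrangianRestriction

/-! ### The abstract commutation formula and Cartan's formula. -/

section Evolution

variable {sL sN : Z → Bool} {ρL ρN : R →ₐ[ℝ] R} {Δ V X : R} {e : ℕ}

/-- The commutator of the evolution along an odd field `V` with the interior product `ι_X`. -/
theorem evolution_interior (hL : IsLagrangianRestriction C sL ρL)
    (hN : IsLagrangianRestriction C sN ρN)
    (hΔ : C.Homogeneous 1 Δ) (hΔL : ρL Δ = 0)
    (hΔN : ∀ z w, sN z = true → sN w = true → ρN (C.D z (C.D w Δ)) = C.D z (C.D w Δ))
    (hV : C.Homogeneous 1 V) (hVL : ρL V = 0) (hVN : ρN V = V)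
    (hX : C.Homogeneous e X) (hXL : ρL X = 0) (hXN : ρN X = X) (w : R) :
    ρL (C.pb (C.pb Δ V) (ρL (C.pb (C.invol X) w))) =
      ρL (C.pb (C.invol X) (ρL (C.pb (C.pb Δ V) w))) +
        (-1 : ℝ) ^ e • ρL (C.pb (ρN (C.pb (C.pb Δ V) X)) w) := by
  have hX' : C.invol X = (-1 : ℝ) ^ e • X := hX
  have hL' : ρL (C.pb Δ V) = 0 := hL.pb_eq_zero hΔL hVL
  rw [hL.pb_restrict hL', hL.pb_restrict (by rw [hL.invol, hXL, map_zero]),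
    hN.derived_fixed hΔ hΔN hV hVN hXN, hX']
  simp only [pb_smul_left, pb_smul_right, map_smul]
  -- `{Δ,V}` has parity `1 + 1`, so the Jacobi sign `(-1)^(2e)` is trivial.
  rw [jacobi (hΔ.pb hV) hX]
  simp [pow_mul, add_comm]

/-- Cartan's formula: the Lie derivative along an odd field is minus the evolution. -/
theorem cartan (hL : IsLagrangianRestriction C sL ρL)
    (hΔ : C.Homogeneous 1 Δ) (hΔL : ρL Δ = 0)
    (hV : C.Homogeneous 1 V) (hVL : ρL V = 0) (w : R) :
    ρL (C.pb Δ (ρL (C.pb (C.invol V) w))) - ρL (C.pb (C.invol (C.invol V)) (ρL (C.pb Δ w))) =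
      -ρL (C.pb (C.pb Δ V) w) := by
  have hV' : C.invol V = (-1 : ℝ) • V := by
    rw [← pow_one (-1 : ℝ)]
    exact hV
  rw [hL.pb_restrict hΔL, hL.pb_restrict (by rw [hL.invol, hL.invol, hVL, map_zero, map_zero])]
  simp only [hV', map_smul, smul_smul, pb_smul_left, pb_smul_right]
  -- For two odd arguments the Jacobi sign is `-1`; the terms `{V,{Δ,w}}` cancel and only
  -- `-{{Δ,V},w}` is left.
  rw [jacobi hΔ hV]
  simp

end Evolution

end Restriction

end DiffSuperalgebra

end WeakKoszul

end

noncomputable section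

open scoped ContDiff

namespace WeakKoszul

/-! ### Contractions, parity and supercommutativity in the exterior algebra. -/

section Exterior

open CliffordAlgebra

variable {N N' : Type*} [AddCommGroup N] [Module ℝ N] [AddCommGroup N'] [Module ℝ N']

theorem contractLeft_mul (d : Module.Dual ℝ N) (x y : ExteriorAlgebra ℝ N) :
    contractLeft d (x * y) = contractLeft d x * y + involute x * contractLeft d y := by
  induction x using CliffordAlgebra.left_induction with
  | algebraMap r => simp [contractLeft_algebraMap_mul]
  | add x x' hx hx' =>
    simp only [add_mul, map_add, hx, hx']
    abel
  | ι_mul x v hx =>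
    rw [mul_assoc, contractLeft_ι_mul, hx, contractLeft_ι_mul, map_mul, involute_ι]
    simp only [mul_add, sub_mul, smul_mul_assoc, neg_mul, mul_assoc]
    abel

theorem involute_contractLeft (d : Module.Dual ℝ N) (x : ExteriorAlgebra ℝ N) :
    involute (contractLeft d x) = -contractLeft d (involute x) := by
  induction x using CliffordAlgebra.left_induction with
  | algebraMap r => simp
  | add x x' hx hx' => simp only [map_add, hx, hx', neg_add]
  | ι_mul x v hx =>
    simp only [contractLeft_ι_mul, map_sub, map_smul, map_mul, involute_ι, hx, neg_mul, map_neg,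
      mul_neg]
    abel

theorem contractLeft_map (t : N →ₗ[ℝ] N') (d : Module.Dual ℝ N') (x : ExteriorAlgebra ℝ N) :
    contractLeft d (ExteriorAlgebra.map t x) =
      ExteriorAlgebra.map t (contractLeft (d ∘ₗ t) x) := by
  induction x using CliffordAlgebra.left_induction with
  | algebraMap r => simp
  | add x x' hx hx' => simp only [map_add, hx, hx']
  | ι_mul x v hx =>
    have h : ExteriorAlgebra.map t (CliffordAlgebra.ι 0 v) = CliffordAlgebra.ι 0 (t v) :=
      ExteriorAlgebra.map_apply_ι t v
    simp only [map_mul, h, contractLeft_ι_mul, map_sub, map_smul, hx, LinearMap.comp_apply]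

theorem map_involute (t : N →ₗ[ℝ] N') (x : ExteriorAlgebra ℝ N) :
    ExteriorAlgebra.map t (involute x) = involute (ExteriorAlgebra.map t x) := by
  induction x using CliffordAlgebra.left_induction with
  | algebraMap r => simp
  | add x x' hx hx' => simp only [map_add, hx, hx']
  | ι_mul x v hx =>
    have h : ExteriorAlgebra.map t (CliffordAlgebra.ι 0 v) = CliffordAlgebra.ι 0 (t v) :=
      ExteriorAlgebra.map_apply_ι t v
    simp only [map_mul, h, involute_ι, map_neg, hx]

theorem ι_mul_eq_involute_mul (v : N) (x : ExteriorAlgebra ℝ N) :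
    ExteriorAlgebra.ι ℝ v * x = involute x * ExteriorAlgebra.ι ℝ v := by
  induction x using CliffordAlgebra.left_induction with
  | algebraMap r => simpa using! (Algebra.commutes r (ExteriorAlgebra.ι ℝ v)).symm
  | add x x' hx hx' => simp only [map_add, mul_add, add_mul, hx, hx']
  | ι_mul x u hx =>
    have h : ExteriorAlgebra.ι ℝ v * CliffordAlgebra.ι 0 u =
        -(CliffordAlgebra.ι 0 u * ExteriorAlgebra.ι ℝ v) :=
      eq_neg_of_add_eq_zero_left (ExteriorAlgebra.ι_add_mul_swap v u)
    rw [← mul_assoc, h, neg_mul, mul_assoc, hx, map_mul, involute_ι, neg_mul, neg_mul, mul_assoc]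

theorem involute_iterate_smul {a : ℕ} {x : ExteriorAlgebra ℝ N}
    (hx : involute x = (-1 : ℝ) ^ a • x) (r : ℕ) :
    (⇑(involute (Q := (0 : QuadraticForm ℝ N))))^[r] x = (-1 : ℝ) ^ (a * r) • x := by
  induction r with
  | zero => simp
  | succ r ih =>
    rw [Function.iterate_succ_apply', ih, map_smul, hx, smul_smul, ← pow_add, mul_add, mul_one]

/-- Moving `x` past one generator costs `(-1)^a`, so moving it past `y` applies the parity
involution `a` times to `y`. Only `x` needs to be homogeneous, which makes induction over generators
of `y` possible. -/
theorem mul_eq_mul_involute {a : ℕ} {x : ExteriorAlgebra ℝ N}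
    (hx : involute x = (-1 : ℝ) ^ a • x) (y : ExteriorAlgebra ℝ N) :
    y * x = x * (⇑(involute (Q := (0 : QuadraticForm ℝ N))))^[a] y := by
  rw [← AlgHom.coe_pow]
  induction y using CliffordAlgebra.left_induction with
  | algebraMap r => rw [AlgHom.commutes]; exact Algebra.commutes r x
  | add y y' hy hy' => rw [map_add, add_mul, mul_add, hy, hy']
  | ι_mul y v hy =>
    have h : CliffordAlgebra.ι 0 v * x = x * ((-1 : ℝ) ^ a • CliffordAlgebra.ι 0 v) := by
      rw [mul_smul_comm, ← smul_mul_assoc, ← hx]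
      exact ι_mul_eq_involute_mul v x
    have h' : (involute ^ a) (CliffordAlgebra.ι (0 : QuadraticForm ℝ N) v) =
        (-1 : ℝ) ^ a • CliffordAlgebra.ι 0 v := by
      rw [AlgHom.coe_pow]
      simpa using involute_iterate_smul (a := 1) (x := CliffordAlgebra.ι 0 v) (by simp) a
    rw [mul_assoc, hy, ← mul_assoc, h, map_mul, h', mul_assoc]

theorem supercommute {a b : ℕ} {x y : ExteriorAlgebra ℝ N}
    (hx : involute x = (-1 : ℝ) ^ a • x) (hy : involute y = (-1 : ℝ) ^ b • y) :
    x * y = (-1 : ℝ) ^ (a * b) • (y * x) := by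
  rw [mul_eq_mul_involute hy x, involute_iterate_smul hx, mul_smul_comm]

end Exterior

/-! ### Differential calculus of Grassmann-valued functions. -/

section Norm

variable {n m k : ℕ}

/-- An auxiliary norm, transported from basis coordinates, so that componentwise smoothness and
derivatives become Fréchet calculus of one vector-valued map. -/
instance grassmannNorm : NormedAddCommGroup (Grassmann n m k) :=
  NormedAddCommGroup.induced (Grassmann n m k) _
    (Module.finBasis ℝ (Grassmann n m k)).equivFun
    (Module.finBasis ℝ (Grassmann n m k)).equivFun.injective

instance grassmannNormedSpace : NormedSpace ℝ (Grassmann n m k) :=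
  NormedSpace.induced ℝ (Grassmann n m k) _ (Module.finBasis ℝ (Grassmann n m k)).equivFun

theorem smoothOn_iff_contDiffOn (W : Set (Body n m k)) (f : SuperFun n m k) :
    SmoothOn W f ↔ ContDiffOn ℝ ∞ f W := by
  constructor
  · intro h
    have e : f = fun p => ∑ j, (Module.finBasis ℝ (Grassmann n m k)).repr (f p) j •
        Module.finBasis ℝ (Grassmann n m k) j := by
      funext p
      exact ((Module.finBasis ℝ (Grassmann n m k)).sum_repr (f p)).symm
    rw [e]
    exact ContDiffOn.sum fun j _ => ((smoothOn_iff W f).1 h j).smul contDiffOn_const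
  · intro h l
    exact (LinearMap.toContinuousLinearMap l).contDiff.comp_contDiffOn h

theorem pd_even {z : Coordinate n m k} (hz : Even z.parity) {f : SuperFun n m k}
    {p : Body n m k} (hf : DifferentiableAt ℝ f p) :
    pd z f p = fderiv ℝ f p (Pi.single (⟨z, hz⟩ : EvenCoord n m k) 1) := by
  unfold pd
  rw [dif_pos hz]
  conv_rhs => rw [← (Module.finBasis ℝ (Grassmann n m k)).sum_repr (fderiv ℝ f p _)]
  refine Finset.sum_congr rfl fun j _ => ?_
  congr 1
  have := ((LinearMap.toContinuousLinearMap
    ((Module.finBasis ℝ (Grassmann n m k)).coord j)).hasFDerivAt.comp p hf.hasFDerivAt).fderiv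
  exact congrArg (fun u => u (Pi.single (⟨z, hz⟩ : EvenCoord n m k) (1 : ℝ))) this

theorem pd_odd {z : Coordinate n m k} (hz : ¬ Even z.parity) (f : SuperFun n m k)
    (p : Body n m k) :
    pd z f p = CliffordAlgebra.contractLeft
      (LinearMap.proj (⟨z, hz⟩ : OddCoord n m k) : (OddCoord n m k → ℝ) →ₗ[ℝ] ℝ) (f p) := by
  unfold pd
  rw [dif_neg hz]

theorem pd_congr {z : Coordinate n m k} {f g : SuperFun n m k} {p : Body n m k}
    (h : f =ᶠ[nhds p] g) : pd z f p = pd z g p := by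
  unfold pd
  split_ifs with hz
  · refine Finset.sum_congr rfl fun j _ => ?_
    congr 2
    exact Filter.EventuallyEq.fderiv_eq (h.fun_comp
      fun x => (Module.finBasis ℝ (Grassmann n m k)).repr x j)
  · rw [h.eq_of_nhds]

variable {W : Set (Body n m k)} {f g : SuperFun n m k}

theorem SmoothOn.differentiableAt (hW : IsOpen W) (hf : SmoothOn W f) {p : Body n m k}
    (hp : p ∈ W) : DifferentiableAt ℝ f p :=
  (((smoothOn_iff_contDiffOn W f).1 hf).contDiffAt (hW.mem_nhds hp)).differentiableAt (by simp)

theorem SmoothOn.linear (hf : SmoothOn W f) (T : Grassmann n m k →ₗ[ℝ] Grassmann n m k) :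
    SmoothOn W fun p => T (f p) := fun l => hf (l ∘ₗ T)

theorem SmoothOn.congr (hf : SmoothOn W f) (h : Set.EqOn g f W) : SmoothOn W g :=
  fun l => (hf l).congr fun p hp => by rw [h hp]

theorem SmoothOn.pd (hW : IsOpen W) (hf : SmoothOn W f) (z : Coordinate n m k) :
    SmoothOn W (pd z f) := by
  by_cases hz : Even z.parity
  · rw [smoothOn_iff_contDiffOn] at *
    have h : ContDiffOn ℝ ∞ (fun p => fderiv ℝ f p
        (Pi.single (⟨z, hz⟩ : EvenCoord n m k) (1 : ℝ))) W :=
      (hf.fderiv_of_isOpen hW (by simp)).clm_apply contDiffOn_const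
    exact h.congr fun p hp => pd_even hz (((hf.contDiffAt (hW.mem_nhds hp))).differentiableAt
      (by simp))
  · have := hf.linear (CliffordAlgebra.contractLeft
      (LinearMap.proj (⟨z, hz⟩ : OddCoord n m k) : (OddCoord n m k → ℝ) →ₗ[ℝ] ℝ))
    exact this.congr fun p _ => pd_odd hz f p

theorem pd_linear {z : Coordinate n m k} (hz : Even z.parity) {p : Body n m k}
    (hf : DifferentiableAt ℝ f p) (T : Grassmann n m k →ₗ[ℝ] Grassmann n m k) :
    WeakKoszul.pd z (fun q => T (f q)) p = T (WeakKoszul.pd z f p) := by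
  have h : HasFDerivAt (fun q => T (f q)) _ p := (LinearMap.toContinuousLinearMap T).hasFDerivAt.comp p hf.hasFDerivAt
  rw [pd_even hz h.differentiableAt, pd_even hz hf]
  exact congrArg (fun u => u (Pi.single (⟨z, hz⟩ : EvenCoord n m k) (1 : ℝ))) h.fderiv

theorem pd_add {z : Coordinate n m k} {p : Body n m k} (hf : DifferentiableAt ℝ f p)
    (hg : DifferentiableAt ℝ g p) :
    pd z (f + g) p = pd z f p + pd z g p := by
  by_cases hz : Even z.parity
  · rw [pd_even hz (hf.add hg), pd_even hz hf, pd_even hz hg, fderiv_add hf hg]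
    rfl
  · simp only [pd_odd hz, Pi.add_apply, map_add]

theorem pd_smul {z : Coordinate n m k} {p : Body n m k} (hf : DifferentiableAt ℝ f p) (t : ℝ) :
    pd z (t • f) p = t • pd z f p := by
  by_cases hz : Even z.parity
  · simpa using! pd_linear hz hf (LinearMap.lsmul ℝ (Grassmann n m k) t)
  · simp only [pd_odd hz, Pi.smul_apply, map_smul]

theorem iterate_involute_congr {r t : ℕ} (h : Even r ↔ Even t) (x : Grassmann n m k) :
    (⇑(CliffordAlgebra.involute (Q := (0 : QuadraticForm ℝ (OddCoord n m k → ℝ)))))^[r] x =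
      (⇑(CliffordAlgebra.involute (Q := (0 : QuadraticForm ℝ (OddCoord n m k → ℝ)))))^[t] x := by
  have hi : Function.Involutive
      (⇑(CliffordAlgebra.involute (Q := (0 : QuadraticForm ℝ (OddCoord n m k → ℝ))))) :=
    CliffordAlgebra.involute_involutive
  by_cases hr : Even r
  · rw [hi.iterate_even hr, hi.iterate_even (h.1 hr)]
  · rw [hi.iterate_odd (Nat.not_even_iff_odd.1 hr),
      hi.iterate_odd (Nat.not_even_iff_odd.1 fun ht => hr (h.2 ht))]

theorem twist_congr {r t : ℕ} (h : Even r ↔ Even t) (f : SuperFun n m k) : twist r f = twist t f :=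
  funext fun p => iterate_involute_congr h (f p)

/-- For even `z` this is the Leibniz rule for Fréchet derivatives of a bilinear product and the
twist is trivial; for odd `z` it is the antiderivation property of contraction. -/
theorem pd_mul {z : Coordinate n m k} {p : Body n m k} (hf : DifferentiableAt ℝ f p)
    (hg : DifferentiableAt ℝ g p) :
    pd z (f * g) p = pd z f p * g p + twist z.parity f p * pd z g p := by
  by_cases hz : Even z.parity
  · have h := (LinearMap.mul ℝ (Grassmann n m k)).toContinuousBilinearMap.hasFDerivAt_of_bilinear
      hf.hasFDerivAt hg.hasFDerivAt
    have h' : HasFDerivAt (f * g) _ p := h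
    rw [pd_even hz h'.differentiableAt, pd_even hz hf, pd_even hz hg, h'.fderiv,
      twist_congr (t := 0) (by simpa using hz)]
    exact add_comm _ _
  · rw [twist_congr (t := 1) (by simpa using hz)]
    simp only [pd_odd hz, Pi.mul_apply, contractLeft_mul]
    rfl

theorem involute_pd {z : Coordinate n m k} {p : Body n m k} (hf : DifferentiableAt ℝ f p) :
    CliffordAlgebra.involute (pd z f p) = (-1 : ℝ) ^ z.parity • pd z (twist 1 f) p := by
  by_cases hz : Even z.parity
  · rw [hz.neg_one_pow, one_smul]
    exact (pd_linear hz hf (CliffordAlgebra.involute (Q := (0 : QuadraticForm ℝ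
      (OddCoord n m k → ℝ)))).toLinearMap).symm
  · rw [(Nat.not_even_iff_odd.1 hz).neg_one_pow, neg_one_smul, pd_odd hz, pd_odd hz,
      involute_contractLeft]
    rfl

/-- Two even derivatives commute by symmetry of the second derivative, an odd and an even one
because contraction is a constant linear map, and two odd ones anticommute as contractions. -/
theorem SmoothOn.pd_comm (hW : IsOpen W) (hf : SmoothOn W f) (z w : Coordinate n m k)
    {p : Body n m k} (hp : p ∈ W) :
    WeakKoszul.pd z (WeakKoszul.pd w f) p =
      (-1 : ℝ) ^ (z.parity * w.parity) • WeakKoszul.pd w (WeakKoszul.pd z f) p := by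
  have hfp := hf.differentiableAt hW hp
  have odd_even : ∀ z w : Coordinate n m k, ¬ Even z.parity → Even w.parity →
      WeakKoszul.pd z (WeakKoszul.pd w f) p = WeakKoszul.pd w (WeakKoszul.pd z f) p := by
    intro z w hz hw
    rw [pd_odd hz, ← pd_linear hw hfp]
    congr 1
    funext q
    rw [pd_odd hz]
  by_cases hz : Even z.parity <;> by_cases hw : Even w.parity
  · rw [(hz.mul_right _).neg_one_pow, one_smul]
    have hC := ((smoothOn_iff_contDiffOn W f).1 hf).contDiffAt (hW.mem_nhds hp)
    have hd : DifferentiableAt ℝ (fderiv ℝ f) p :=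
      (hC.fderiv_right (m := ∞) (by simp)).differentiableAt (by simp)
    have second : ∀ (z w : Coordinate n m k) (hz : Even z.parity) (hw : Even w.parity),
        WeakKoszul.pd z (WeakKoszul.pd w f) p = fderiv ℝ (fderiv ℝ f) p
          (Pi.single (⟨z, hz⟩ : EvenCoord n m k) 1) (Pi.single (⟨w, hw⟩ : EvenCoord n m k) 1) := by
      intro z w hz hw
      rw [pd_even hz ((hf.pd hW w).differentiableAt hW hp)]
      have e : WeakKoszul.pd w f =ᶠ[nhds p]
          fun q => fderiv ℝ f q (Pi.single (⟨w, hw⟩ : EvenCoord n m k) 1) := by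
        filter_upwards [hW.mem_nhds hp] with q hq
        exact pd_even hw (hf.differentiableAt hW hq)
      rw [e.fderiv_eq, fderiv_clm_apply hd (differentiableAt_const _)]
      simp
    rw [second z w hz hw, second w z hw hz]
    exact (hC.isSymmSndFDerivAt
      (by simpa using (WithTop.coe_le_coe.2 le_top : ((2 : ℕ∞) : ℕ∞ω) ≤ ∞))).eq _ _
  · rw [(hz.mul_right _).neg_one_pow, one_smul, odd_even w z hw hz]
  · rw [(hw.mul_left _).neg_one_pow, one_smul, odd_even z w hz hw]
  · rw [((Nat.not_even_iff_odd.1 hz).mul (Nat.not_even_iff_odd.1 hw)).neg_one_pow, neg_one_smul]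
    simp only [pd_odd hz, pd_odd hw]
    exact CliffordAlgebra.contractLeft_comm _ _ _

/-- The point with the coordinates selected by `s` set to zero. -/
def restrictPoint (s : Coordinate n m k → Bool) : Body n m k →ₗ[ℝ] Body n m k :=
  LinearMap.pi fun z => if s z.1 then 0 else LinearMap.proj z

/-- The linear map which kills the odd generators selected by `s`. -/
def restrictOdd (s : Coordinate n m k → Bool) : (OddCoord n m k → ℝ) →ₗ[ℝ] (OddCoord n m k → ℝ) :=
  LinearMap.pi fun z => if s z.1 then 0 else LinearMap.proj z

theorem restrictPoint_apply (s : Coordinate n m k → Bool) (p : Body n m k) (z : EvenCoord n m k) :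
    restrictPoint s p z = if s z.1 then 0 else p z := by
  unfold restrictPoint
  rw [LinearMap.pi_apply]
  split_ifs <;> rfl

theorem restrictOdd_apply (s : Coordinate n m k → Bool) (v : OddCoord n m k → ℝ)
    (z : OddCoord n m k) : restrictOdd s v z = if s z.1 then 0 else v z := by
  unfold restrictOdd
  rw [LinearMap.pi_apply]
  split_ifs <;> rfl

theorem restrict_apply (s : Coordinate n m k → Bool) (f : SuperFun n m k) (p : Body n m k) :
    restrict s f p = ExteriorAlgebra.map (restrictOdd s) (f (restrictPoint s p)) := by
  unfold restrict
  congr 2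
  funext z
  rw [restrictPoint_apply]

theorem restrictPoint_single (s : Coordinate n m k → Bool) (z : EvenCoord n m k) :
    restrictPoint s (Pi.single z 1) = if s z.1 then 0 else Pi.single z 1 := by
  funext w
  rw [restrictPoint_apply]
  by_cases h : w = z
  · subst h
    split_ifs <;> simp
  · split_ifs <;> simp [Pi.single_eq_of_ne h]

theorem SmoothOn.restrict {s : Coordinate n m k → Bool} (hf : SmoothOn W f)
    (hs : Set.MapsTo (restrictPoint s) W W) : SmoothOn W (restrict s f) := by
  have h : SmoothOn W fun p => f (restrictPoint s p) := fun l =>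
    (hf l).comp (LinearMap.toContinuousLinearMap (restrictPoint s)).contDiff.contDiffOn hs
  exact (h.linear (ExteriorAlgebra.map (restrictOdd s)).toLinearMap).congr
    fun p _ => restrict_apply s f p

/-- Chain rule: restriction is pullback along a linear projection which kills the selected
directions and fixes the others. -/
theorem pd_restrict {s : Coordinate n m k → Bool} {p : Body n m k}
    (hf : DifferentiableAt ℝ f (restrictPoint s p)) (z : Coordinate n m k) :
    pd z (restrict s f) p = if s z then 0 else restrict s (pd z f) p := by
  have e : restrict s f =
      fun q => (ExteriorAlgebra.map (restrictOdd s)).toLinearMap (f (restrictPoint s q)) :=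
    funext fun q => restrict_apply s f q
  by_cases hz : Even z.parity
  · have h : HasFDerivAt (fun q => f (restrictPoint s q)) _ p :=
      hf.hasFDerivAt.comp p (LinearMap.toContinuousLinearMap (restrictPoint s)).hasFDerivAt
    rw [e, pd_linear hz h.differentiableAt, pd_even hz h.differentiableAt, h.fderiv,
      restrict_apply, pd_even hz hf]
    simp only [ContinuousLinearMap.comp_apply, LinearMap.coe_toContinuousLinearMap',
      restrictPoint_single]
    split_ifs <;> simp
  · rw [e, pd_odd hz, restrict_apply, pd_odd hz]
    refine (contractLeft_map _ _ _).trans ?_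
    have : (LinearMap.proj (⟨z, hz⟩ : OddCoord n m k) : (OddCoord n m k → ℝ) →ₗ[ℝ] ℝ) ∘ₗ
        restrictOdd s = if s z then 0 else LinearMap.proj (⟨z, hz⟩ : OddCoord n m k) := by
      ext v
      rw [LinearMap.comp_apply, LinearMap.comp_apply, LinearMap.proj_apply, restrictOdd_apply]
      split_ifs <;> simp
    rw [this]
    split_ifs <;> simp

theorem restrict_restrict {s t : Coordinate n m k → Bool} (h : ∀ z, t z = true → s z = true)
    (f : SuperFun n m k) : restrict s (restrict t f) = restrict s f := by
  funext p
  simp only [restrict_apply]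
  have h1 : restrictPoint t (restrictPoint s p) = restrictPoint s p := by
    funext z
    simp only [restrictPoint_apply]
    split_ifs with ht hs
    · rfl
    · exact absurd (h _ ht) hs
    · rfl
    · rfl
  have h2 : restrictOdd s ∘ₗ restrictOdd t = restrictOdd s := by
    refine LinearMap.ext fun v => funext fun z => ?_
    simp only [restrictOdd_apply, LinearMap.comp_apply]
    split_ifs with hs ht
    · rfl
    · exact absurd (h _ ht) hs
    · rfl
  rw [h1, ← AlgHom.comp_apply, ExteriorAlgebra.map_comp_map, h2]

theorem restrict_coord {s : Coordinate n m k → Bool} {z : Coordinate n m k} (hz : s z = true) :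
    restrict s (coord z) = 0 := by
  funext p
  rw [restrict_apply, coord]
  split_ifs with h
  · simp [restrictPoint_apply, hz]
  · have : restrictOdd s (Pi.single (⟨z, h⟩ : OddCoord n m k) 1) = 0 := by
      funext w
      rw [restrictOdd_apply]
      by_cases hw : w = ⟨z, h⟩
      · subst hw
        simp [hz]
      · simp [Pi.single_eq_of_ne hw]
    rw [ExteriorAlgebra.map_apply_ι, this, map_zero]
    rfl

theorem pd_coord (z w : Coordinate n m k) (p : Body n m k) :
    pd z (coord w) p = if z = w then 1 else 0 := by
  have hd : DifferentiableAt ℝ (coord w) p :=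
    (smoothOn_coord Set.univ w).differentiableAt isOpen_univ (Set.mem_univ p)
  by_cases hz : Even z.parity
  · rw [pd_even hz hd]
    by_cases hw : Even w.parity
    · have e : coord w = fun q : Body n m k =>
          LinearMap.toContinuousLinearMap ((Algebra.linearMap ℝ (Grassmann n m k)) ∘ₗ
            LinearMap.proj (⟨w, hw⟩ : EvenCoord n m k)) q := by
        funext q
        rw [coord, dif_pos hw]
        rfl
      rw [e, ContinuousLinearMap.fderiv]
      by_cases h : z = w
      · subst h
        simp
      · have h' : (⟨w, hw⟩ : EvenCoord n m k) ≠ ⟨z, hz⟩ := fun h' => h (congrArg Subtype.val h').symm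
        simp [h]
    · have e : coord w = fun _ : Body n m k =>
          ExteriorAlgebra.ι ℝ (Pi.single (⟨w, hw⟩ : OddCoord n m k) (1 : ℝ)) := by
        funext q
        rw [coord, dif_neg hw]
      have h : z ≠ w := fun h => hw (h ▸ hz)
      rw [e]
      simp [h]
  · rw [pd_odd hz, coord]
    split_ifs with hw h h
    · exact absurd (h ▸ hw) hz
    · simp
    · subst h
      simp [ExteriorAlgebra.ι]
    · have h' : (⟨z, hz⟩ : OddCoord n m k) ≠ ⟨w, hw⟩ := fun h' => h (congrArg Subtype.val h')
      simp [ExteriorAlgebra.ι, Pi.single_eq_of_ne h']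

end Norm

end WeakKoszul

end

/-! ### Smooth functions over an open set as a differential superalgebra. -/

noncomputable section

open scoped ContDiff Manifold

namespace WeakKoszul

variable {n m k : ℕ}

/-- A representative of the parity of a coordinate which agrees for conjugate coordinates. -/
def Coordinate.par (z : Coordinate n m k) : ℕ :=
  z.2.parity + if z.1.1 = z.1.2 then 0 else 1

theorem Coordinate.even_par (z : Coordinate n m k) : Even z.par ↔ Even z.parity := by
  rcases z with ⟨⟨_ | _, _ | _⟩, A⟩ <;> simp [Coordinate.par, Coordinate.parity, Nat.even_add]

/-- The coordinate conjugate with respect to the Poisson bracket. -/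
def Coordinate.conj (z : Coordinate n m k) : Coordinate n m k := ((!z.1.1, !z.1.2), z.2)

/-- The constants of the canonical Poisson bracket. -/
def Coordinate.bracketSign (z : Coordinate n m k) : ℝ :=
  if z.1.1 then (-1) ^ z.2.parity else if z.1.2 then 1 else -1

theorem Coordinate.bracketSign_conj (z : Coordinate n m k) :
    z.conj.bracketSign = -(-1 : ℝ) ^ z.par * z.bracketSign := by
  rcases z with ⟨⟨_ | _, _ | _⟩, A⟩ <;> rcases Nat.even_or_odd A.parity with h | h <;>
    simp [Coordinate.par, Coordinate.conj, Coordinate.bracketSign, pow_add, h.neg_one_pow]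

variable {W : Set (Body n m k)}

/-- `f` is an extension of the smooth function `u` on `W`. -/
def Represents (u : smoothFunctions W) (f : SuperFun n m k) : Prop :=
  ∀ p (hp : p ∈ W), u.1 ⟨p, hp⟩ = f p

theorem represents_toSmooth (f : SuperFun n m k) (hf : SmoothOn W f) :
    Represents (toSmooth W f hf) f := fun _ _ => rfl

theorem exists_represents (u : smoothFunctions W) :
    ∃ f : SuperFun n m k, SmoothOn W f ∧ Represents u f := by
  obtain ⟨f, hf, h⟩ := u.2
  exact ⟨f, hf, fun p hp => by rw [← h]; rfl⟩

namespace Represents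

variable {u v : smoothFunctions W} {f g : SuperFun n m k}

theorem eqOn (hf : Represents u f) (hg : Represents u g) : Set.EqOn f g W := fun p hp => by
  rw [← hf p hp, ← hg p hp]

theorem congr (hf : Represents u f) (h : Set.EqOn f g W) : Represents u g := fun p hp => by
  rw [hf p hp, h hp]

/-- With `eqOn_of_eq`, this carries identities between equality on `W` of total functions and
equality in `smoothFunctions W`. -/
theorem ext (hf : Represents u f) (hg : Represents v g) (h : Set.EqOn f g W) : u = v :=
  Subtype.ext (funext fun p => by rw [hf p.1 p.2, hg p.1 p.2, h p.2])

theorem eqOn_of_eq (hf : Represents u f) (hg : Represents v g) (h : u = v) : Set.EqOn f g W :=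
  hf.eqOn (h ▸ hg)

theorem smoothOn (hf : Represents u f) : SmoothOn W f := by
  obtain ⟨g, hg, hug⟩ := exists_represents u
  exact hg.congr (hf.eqOn hug)

theorem zero : Represents (0 : smoothFunctions W) 0 := fun _ _ => rfl

theorem add (hf : Represents u f) (hg : Represents v g) : Represents (u + v) (f + g) :=
  fun p hp => congrArg₂ (· + ·) (hf p hp) (hg p hp)

theorem sub (hf : Represents u f) (hg : Represents v g) : Represents (u - v) (f - g) :=
  fun p hp => congrArg₂ (· - ·) (hf p hp) (hg p hp)

theorem mul (hf : Represents u f) (hg : Represents v g) : Represents (u * v) (f * g) :=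
  fun p hp => congrArg₂ (· * ·) (hf p hp) (hg p hp)

theorem smul (hf : Represents u f) (t : ℝ) : Represents (t • u) (t • f) :=
  fun p hp => congrArg (t • ·) (hf p hp)

theorem sum {ι : Type*} (s : Finset ι) {u : ι → smoothFunctions W} {f : ι → SuperFun n m k}
    (h : ∀ i ∈ s, Represents (u i) (f i)) : Represents (∑ i ∈ s, u i) (∑ i ∈ s, f i) := by
  classical
  induction s using Finset.induction_on with
  | empty => exact zero
  | insert i s hi ih =>
    rw [Finset.sum_insert hi, Finset.sum_insert hi]
    exact (h i (Finset.mem_insert_self i s)).add (ih fun j hj => h j (Finset.mem_insert_of_mem hj))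

end Represents

/-- An extension of a smooth function on `W`. -/
def extension (u : smoothFunctions W) : SuperFun n m k := (exists_represents u).choose

theorem smoothOn_extension (u : smoothFunctions W) : SmoothOn W (extension u) :=
  (exists_represents u).choose_spec.1

theorem represents_extension (u : smoothFunctions W) : Represents u (extension u) :=
  (exists_represents u).choose_spec.2

theorem twist_one_apply (f : SuperFun n m k) (p : Body n m k) :
    twist 1 f p = CliffordAlgebra.involute (f p) := rfl

theorem twist_succ (r : ℕ) (f : SuperFun n m k) : twist (r + 1) f = twist 1 (twist r f) :=
  funext fun p => Function.iterate_succ_apply' _ r (f p)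

theorem SmoothOn.twist_one {f : SuperFun n m k} (hf : SmoothOn W f) : SmoothOn W (twist 1 f) :=
  hf.linear (CliffordAlgebra.involute (Q := (0 : QuadraticForm ℝ
    (OddCoord n m k → ℝ)))).toLinearMap

/-- The parity involution of the algebra of smooth functions. -/
def smoothInvol : smoothFunctions W →ₐ[ℝ] smoothFunctions W :=
  ((CliffordAlgebra.involute.compLeft W).comp (smoothFunctions W).val).codRestrict _ fun u =>
    ⟨twist 1 (extension u), (smoothOn_extension u).twist_one, funext fun p =>
      congrArg CliffordAlgebra.involute (represents_extension u p.1 p.2).symm⟩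

theorem Represents.invol {u : smoothFunctions W} {f : SuperFun n m k} (hf : Represents u f) :
    Represents (smoothInvol u) (twist 1 f) := fun p hp =>
  congrArg CliffordAlgebra.involute (hf p hp)

theorem Represents.twist {u : smoothFunctions W} {f : SuperFun n m k} (hf : Represents u f)
    (r : ℕ) : Represents ((⇑smoothInvol)^[r] u) (twist r f) := by
  induction r with
  | zero => exact hf
  | succ r ih =>
    rw [Function.iterate_succ_apply', twist_succ]
    exact ih.invol

/-- Derivatives are local, so on an open set they do not depend on the chosen extension. -/
theorem pd_eqOn (hW : IsOpen W) {f g : SuperFun n m k} (h : Set.EqOn f g W)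
    (z : Coordinate n m k) : Set.EqOn (pd z f) (pd z g) W := fun _ hp =>
  pd_congr (h.eventuallyEq_of_mem (hW.mem_nhds hp))

/-- The partial derivatives on the algebra of smooth functions. -/
def smoothPd (hW : IsOpen W) (z : Coordinate n m k) :
    smoothFunctions W →ₗ[ℝ] smoothFunctions W where
  toFun u := toSmooth W (pd z (extension u)) ((smoothOn_extension u).pd hW z)
  map_add' u v := by
    refine (represents_toSmooth _ _).ext ((represents_toSmooth _ _).add (represents_toSmooth _ _)) ?_
    refine (pd_eqOn hW ((represents_extension _).eqOn
      ((represents_extension u).add (represents_extension v))) z).trans fun p hp => ?_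
    exact pd_add ((smoothOn_extension u).differentiableAt hW hp)
      ((smoothOn_extension v).differentiableAt hW hp)
  map_smul' t u := by
    refine (represents_toSmooth _ _).ext ((represents_toSmooth _ _).smul t) ?_
    refine (pd_eqOn hW ((represents_extension _).eqOn
      ((represents_extension u).smul t)) z).trans fun p hp => ?_
    exact pd_smul ((smoothOn_extension u).differentiableAt hW hp) t

theorem Represents.pd (hW : IsOpen W) {u : smoothFunctions W} {f : SuperFun n m k}
    (hf : Represents u f) (z : Coordinate n m k) : Represents (smoothPd hW z u) (pd z f) :=
  (represents_toSmooth _ ((smoothOn_extension u).pd hW z)).congr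
    (pd_eqOn hW ((represents_extension u).eqOn hf) z)

/-- The differential superalgebra of smooth functions over the open set `W`. -/
def smoothSuperalgebra (hW : IsOpen W) :
    DiffSuperalgebra (Coordinate n m k) (smoothFunctions W) where
  par := Coordinate.par
  invol := smoothInvol
  D := smoothPd hW
  D_mul z u v := by
    have hu := represents_extension u
    have hv := represents_extension v
    refine ((hu.mul hv).pd hW z).ext
      (((hu.pd hW z).mul hv).add ((hu.twist z.par).mul (hv.pd hW z))) fun p hp => ?_
    rw [pd_mul (hu.smoothOn.differentiableAt hW hp) (hv.smoothOn.differentiableAt hW hp),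
      twist_congr z.even_par]
    rfl
  invol_D z u := by
    have hu := represents_extension u
    refine (hu.pd hW z).invol.ext ((hu.invol.pd hW z).smul _) fun p hp => ?_
    rw [neg_one_pow_congr z.even_par]
    exact involute_pd (hu.smoothOn.differentiableAt hW hp)
  D_comm z w u := by
    have hu := represents_extension u
    refine ((hu.pd hW w).pd hW z).ext (((hu.pd hW z).pd hW w).smul _) fun p hp => ?_
    rw [neg_one_pow_congr (n := z.parity * w.parity)
      (by rw [Nat.even_mul, Nat.even_mul, z.even_par, w.even_par])]
    exact hu.smoothOn.pd_comm hW z w hp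
  supercomm a b u v hu hv := Subtype.ext <| funext fun p =>
    supercommute (congrFun (congrArg Subtype.val hu) p) (congrFun (congrArg Subtype.val hv) p)
  conj := Coordinate.conj
  conj_conj z := by simp [Coordinate.conj]
  par_conj z := by simp [Coordinate.conj, Coordinate.par]
  κ := Coordinate.bracketSign
  κ_conj := Coordinate.bracketSign_conj

/-- The four terms for each `A` in the explicit bracket are the terms of one sum over all
coordinates `z`, with `z` acting on the left factor and `z.conj` on the right. -/
theorem Represents.bracket (hW : IsOpen W) {u v : smoothFunctions W} {f g : SuperFun n m k}
    (hf : Represents u f) (hg : Represents v g) :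
    Represents ((smoothSuperalgebra hW).pb u v) (bracket f g) := by
  have e : WeakKoszul.bracket f g = ∑ z : Coordinate n m k,
      z.bracketSign • (WeakKoszul.pd z (WeakKoszul.twist z.par f) * WeakKoszul.pd z.conj g) := by
    unfold WeakKoszul.bracket
    rw [Fintype.sum_prod_type_right]
    refine Finset.sum_congr rfl fun A _ => ?_
    rw [Fintype.sum_prod_type, Fintype.sum_bool, Fintype.sum_bool, Fintype.sum_bool]
    simp [Coordinate.bracketSign, Coordinate.par, Coordinate.conj]
    abel
  rw [e]
  exact Represents.sum _ fun z _ => (((hf.twist z.par).pd hW z).mul (hg.pd hW z.conj)).smul _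

/-- Restriction to a coordinate subspace on the algebra of smooth functions. -/
def smoothRestrict {s : Coordinate n m k → Bool} (hs : Set.MapsTo (restrictPoint s) W W) :
    smoothFunctions W →ₐ[ℝ] smoothFunctions W :=
  (AlgHom.pi fun p : W => (ExteriorAlgebra.map (restrictOdd s)).comp
    ((Pi.evalAlgHom ℝ (fun _ : W => Grassmann n m k) (hs.restrict _ W W p)).comp
      (smoothFunctions W).val)).codRestrict _ fun u =>
    ⟨restrict s (extension u), (smoothOn_extension u).restrict hs, funext fun p =>
      (restrict_apply s _ p.1).trans (congrArg (ExteriorAlgebra.map (restrictOdd s))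
        (represents_extension u _ (hs p.2)).symm)⟩

theorem Represents.restrict {s : Coordinate n m k → Bool}
    (hs : Set.MapsTo (restrictPoint s) W W) {u : smoothFunctions W} {f : SuperFun n m k}
    (hf : Represents u f) : Represents (smoothRestrict hs u) (restrict s f) := fun p hp =>
  (congrArg (ExteriorAlgebra.map (restrictOdd s)) (hf _ (hs hp))).trans (restrict_apply s f p).symm

theorem smoothRestrict_isLagrangian (hW : IsOpen W) {s : Coordinate n m k → Bool}
    (hs : Set.MapsTo (restrictPoint s) W W) (hc : ∀ z : Coordinate n m k, s z.conj = !s z) :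
    (smoothSuperalgebra hW).IsLagrangianRestriction s (smoothRestrict hs) where
  conj := hc
  idem u := by
    have hu := represents_extension u
    refine ((hu.restrict hs).restrict hs).ext (hu.restrict hs) ?_
    rw [restrict_restrict fun _ h => h]
    exact Set.eqOn_refl _ _
  invol u := by
    have hu := represents_extension u
    refine (hu.invol.restrict hs).ext (hu.restrict hs).invol fun p _ => ?_
    rw [restrict_apply, twist_one_apply, twist_one_apply, restrict_apply]
    exact map_involute _ _
  D_tangent z hz u := by
    have hu := represents_extension u
    refine ((hu.restrict hs).pd hW z).ext ((hu.pd hW z).restrict hs) fun p hp => ?_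
    rw [pd_restrict (hu.smoothOn.differentiableAt hW (hs hp)), hz]
    rfl
  D_normal z hz u := by
    have hu := represents_extension u
    refine ((hu.restrict hs).pd hW z).ext .zero fun p hp => ?_
    rw [pd_restrict (hu.smoothOn.differentiableAt hW (hs hp)), hz]
    rfl

/-- The coordinate functions. -/
def smoothCoord (W : Set (Body n m k)) (z : Coordinate n m k) : smoothFunctions W :=
  toSmooth W (coord z) (smoothOn_coord W z)

theorem smoothPd_coord (hW : IsOpen W) (z w : Coordinate n m k) :
    smoothPd hW z (smoothCoord W w) = if z = w then 1 else 0 :=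
  Subtype.ext <| funext fun p => by
    refine ((represents_toSmooth (coord w) (smoothOn_coord W w)).pd hW z p.1 p.2).trans ?_
    rw [pd_coord]
    split_ifs <;> rfl

theorem smoothRestrict_coord {s : Coordinate n m k → Bool}
    (hs : Set.MapsTo (restrictPoint s) W W) {z : Coordinate n m k} (hz : s z = true) :
    smoothRestrict hs (smoothCoord W z) = 0 :=
  ((represents_toSmooth _ _).restrict hs).ext .zero (by rw [restrict_coord hz]; exact fun _ _ => rfl)

theorem homogeneous_coord (hW : IsOpen W) (z : Coordinate n m k) :
    (smoothSuperalgebra hW).Homogeneous z.par (smoothCoord W z) := by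
  have h := represents_toSmooth (coord z) (smoothOn_coord W z)
  refine h.invol.ext (h.smul _) fun p _ => ?_
  rw [neg_one_pow_congr z.even_par, twist_one_apply, Pi.smul_apply, coord]
  split_ifs with hz
  · rw [hz.neg_one_pow, one_smul, AlgHom.commutes]
  · rw [(Nat.not_even_iff_odd.1 hz).neg_one_pow, neg_one_smul]
    exact CliffordAlgebra.involute_ι _

/-- The canonical odd function in the algebra of smooth functions. -/
def smoothDelta (W : Set (Body n m k)) : smoothFunctions W :=
  ∑ A : Idx n m k, (-1 : ℝ) ^ A.parity • (smoothCoord W (dfld A) * smoothCoord W (dmom A))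

theorem represents_delta : Represents (smoothDelta W) canonicalDelta :=
  Represents.sum _ fun _ _ =>
    ((represents_toSmooth _ _).mul (represents_toSmooth _ _)).smul _

theorem homogeneous_delta (hW : IsOpen W) :
    (smoothSuperalgebra hW).Homogeneous 1 (smoothDelta W) := by
  refine .sum _ fun A _ => .smul (((homogeneous_coord hW (dfld A)).mul
    (homogeneous_coord hW (dmom A))).congr ?_) _
  refine neg_one_pow_congr ?_
  by_cases h : Even A.parity <;> simp [Coordinate.par, Nat.even_add, h]

/-- The second derivatives of `Δ` are constant. -/
theorem restrict_pd_pd_delta (hW : IsOpen W) {s : Coordinate n m k → Bool}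
    (hs : Set.MapsTo (restrictPoint s) W W) (z w : Coordinate n m k) :
    smoothRestrict hs (smoothPd hW z (smoothPd hW w (smoothDelta W))) =
      smoothPd hW z (smoothPd hW w (smoothDelta W)) := by
  -- Writing indicators as real multiples of `1` lets `simp` reduce every second derivative of `Δ`
  -- to a constant, which the restriction fixes.
  have hite : ∀ (P : Prop) [Decidable P],
      (if P then (1 : smoothFunctions W) else 0) = (if P then (1 : ℝ) else 0) • 1 := by
    intro P _
    split_ifs <;> simp
  have hmul : ∀ z (u v : smoothFunctions W), smoothPd hW z (u * v) =
      smoothPd hW z u * v + (⇑smoothInvol)^[z.par] u * smoothPd hW z v :=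
    (smoothSuperalgebra hW).D_mul
  have hit : ∀ z r, (⇑smoothInvol)^[r] (smoothCoord W z) =
      (-1 : ℝ) ^ (z.par * r) • smoothCoord W z := fun z r => (homogeneous_coord hW z).iterate r
  simp only [smoothDelta, map_sum, map_smul, hmul, smoothPd_coord, map_add, hite, hit,
    smul_mul_assoc, mul_smul_comm, one_mul, mul_one, map_one]

end WeakKoszul

end

/-! ### Transfer to coordinate domains and the conclusion. -/

noncomputable section

open scoped ContDiff Manifold
open Bundle

namespace WeakKoszul

section Global

variable {n m k : ℕ} {M : Type*} [TopologicalSpace M]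
  [ChartedSpace (EuclideanSpace ℝ (Fin n)) M]
  {E : M → Type*} [∀ x, TopologicalSpace (E x)] [TopologicalSpace (TotalSpace (Fin m → ℝ) E)]
  [FiberBundle (Fin m → ℝ) E]
  {F : M → Type*} [∀ x, TopologicalSpace (F x)] [TopologicalSpace (TotalSpace (Fin k → ℝ) F)]
  [FiberBundle (Fin k → ℝ) F]

theorem continuous_xPart : Continuous (xPart (n := n) (m := m) (k := k)) :=
  (PiLp.continuous_toLp 2 _).comp (continuous_pi fun _ => continuous_apply _)

theorem xPart_restrictPoint {s : Coordinate n m k → Bool} (hs : ∀ A, s (fld A) = false)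
    (p : Body n m k) : xPart (restrictPoint s p) = xPart p := by
  unfold xPart
  congr 1
  funext i
  rw [restrictPoint_apply, hs]
  rfl

theorem CoordSystem.isOpen_domain (c : CoordSystem (n := n) (m := m) (k := k) E F) :
    IsOpen c.domain :=
  (c.chart.symm.isOpen_inter_preimage (c.chart.open_source.inter
    (c.trivE.open_baseSet.inter c.trivF.open_baseSet))).preimage continuous_xPart

theorem CoordSystem.mapsTo_domain (c : CoordSystem (n := n) (m := m) (k := k) E F)
    {s : Coordinate n m k → Bool} (hs : ∀ A, s (fld A) = false) :
    Set.MapsTo (restrictPoint s) c.domain c.domain := by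
  intro p hp
  unfold CoordSystem.domain CoordSystem.point at *
  simpa only [Set.mem_ofPred_eq, xPart_restrictPoint hs] using hp

/-- A function of momentum degree one has positive momentum degree. -/
theorem HasDegOne.hasPositiveDeg {f : LocalFamily (n := n) (m := m) (k := k) E F}
    (hf : IsGlobal f) (h : HasDegOne f) : HasPositiveDeg f := by
  intro c
  have hM := c.mapsTo_domain (s := fun z => !z.1.1 && z.1.2) fun _ => rfl
  have hu := represents_toSmooth (f c) (hf.smooth c)
  have hsum : Represents (toSmooth c.domain (f c) (hf.smooth c)) (∑ A : Idx n m k, _) :=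
    hu.congr (h c).symm
  -- The function equals `∑ φ*_A ∂f/∂φ*_A` in the algebra, and every term has a factor vanishing on
  -- `φ* = 0`.
  have e := hsum.ext (Represents.sum Finset.univ fun A _ =>
    (represents_toSmooth (coord (mom A)) (smoothOn_coord c.domain _)).mul
      (hu.pd c.isOpen_domain (mom A))) (Set.eqOn_refl _ _)
  refine (hu.restrict hM).eqOn_of_eq .zero ?_
  rw [e, map_sum]
  refine Finset.sum_eq_zero fun A _ => ?_
  rw [map_mul]
  exact (congrArg (· * _) (smoothRestrict_coord hM (z := mom A) rfl)).trans (zero_mul _)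

/-- Functions of positive momentum degree vanish on `ℒ`. -/
theorem HasPositiveDeg.restrictL_eqOn {f : LocalFamily (n := n) (m := m) (k := k) E F}
    (h : HasPositiveDeg f) (c : CoordSystem (n := n) (m := m) (k := k) E F) :
    Set.EqOn (restrictL (f c)) 0 c.domain := by
  intro p hp
  have hp' := c.mapsTo_domain (s := fun z => z.1.2) (fun _ => rfl) hp
  -- Restriction to `ℒ` factors through restriction to `φ* = 0`, where the function already
  -- vanishes.
  rw [restrictL, ← restrict_restrict (t := fun z => !z.1.1 && z.1.2)
    (fun z hz => (Bool.and_eq_true_iff.1 hz).2), restrict_apply]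
  have h0 : restrict (fun z => !z.1.1 && z.1.2) (f c) (restrictPoint _ p) = 0 := h c hp'
  rw [h0, map_zero]
  rfl

theorem smoothRestrict_delta {W : Set (Body n m k)}
    (hs : Set.MapsTo (restrictPoint fun z => z.1.2) W W) :
    smoothRestrict hs (smoothDelta W) = 0 := by
  unfold smoothDelta
  rw [map_sum]
  refine Finset.sum_eq_zero fun A _ => ?_
  rw [map_smul, map_mul, smoothRestrict_coord hs (z := dmom A) rfl, mul_zero, smul_zero]

/-- The commutation of the time derivative and of the Lie derivative along an odd function `V` on
`𝒩` of positive momentum degree with interior products, in local coordinates. -/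
theorem timeDeriv_lieDeriv_interior {W : Set (Body n m k)} (hW : IsOpen W)
    (hL : Set.MapsTo (restrictPoint fun z => z.1.2) W W)
    (hN : Set.MapsTo (restrictPoint fun z => z.1.1) W W)
    {V X w : SuperFun n m k} {e : ℕ} (hV : SmoothOn W V) (hX : SmoothOn W X) (hw : SmoothOn W w)
    (hVpar : Set.EqOn (twist 1 V) ((-1 : ℝ) ^ 1 • V) W)
    (hXpar : Set.EqOn (twist 1 X) ((-1 : ℝ) ^ e • X) W)
    (hVN : Set.EqOn (restrictN V) V W) (hXN : Set.EqOn (restrictN X) X W)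
    (hVL : Set.EqOn (restrictL V) 0 W) (hXL : Set.EqOn (restrictL X) 0 W) :
    Set.EqOn (timeDeriv V (interior X w))
        (interior X (timeDeriv V w)
          + (-1 : ℝ) ^ e • restrictL (bracket (oddBracket V X) w)) W ∧
      Set.EqOn (lieDeriv V (interior X w))
        (interior X (lieDeriv V w)
          + (-1 : ℝ) ^ (e + 1) • restrictL (bracket (oddBracket V X) w)) W := by
  have rV := represents_toSmooth V hV
  have rX := represents_toSmooth X hX
  have rw' := represents_toSmooth w hw
  have rΔ := represents_delta (W := W)
  -- Conjugation flips both flags, so selecting by either flag picks one coordinate of each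
  -- conjugate pair: `ℒ` and `𝒩` are both Lagrangian.
  have lagL := smoothRestrict_isLagrangian hW hL fun _ => rfl
  have lagN := smoothRestrict_isLagrangian hW hN fun _ => rfl
  have homV : (smoothSuperalgebra hW).Homogeneous 1 _ := rV.invol.ext (rV.smul _) hVpar
  have homX : (smoothSuperalgebra hW).Homogeneous e _ := rX.invol.ext (rX.smul _) hXpar
  have homΔ := homogeneous_delta hW
  have zV := (rV.restrict hL).ext .zero hVL
  have zX := (rX.restrict hL).ext .zero hXL
  have fV := (rV.restrict hN).ext rV hVN
  have fX := (rX.restrict hN).ext rX hXN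
  have zΔ := smoothRestrict_delta hL
  have evol := fun u => (DiffSuperalgebra.evolution_interior lagL lagN homΔ zΔ
    (fun z w _ _ => restrict_pd_pd_delta hW hN z w) homV zV fV homX zX fX u)
  have cart := fun u => DiffSuperalgebra.cartan lagL homΔ zΔ homV zV u
  have rι := (rX.invol.bracket hW rw').restrict hL
  have rVX := ((((rΔ.bracket hW rV).bracket hW rX).restrict hN).bracket hW rw').restrict hL
  have rLie : ∀ {u f}, Represents u f → Represents _ (lieDeriv V f) := fun {u f} hf =>
    ((rΔ.bracket hW ((rV.invol.bracket hW hf).restrict hL)).restrict hL).sub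
      ((rV.invol.invol.bracket hW ((rΔ.bracket hW hf).restrict hL)).restrict hL)
  constructor
  · exact (((rΔ.bracket hW rV).bracket hW rι).restrict hL).eqOn_of_eq
      (((rX.invol.bracket hW (((rΔ.bracket hW rV).bracket hW rw').restrict hL)).restrict hL).add
        (rVX.smul _)) (evol _)
  · refine (rLie rι).eqOn_of_eq (((rX.invol.bracket hW (rLie rw')).restrict hL).add
      (rVX.smul _)) ?_
    -- Cartan's formula turns the outer Lie derivative into minus the evolution, the first formula
    -- is applied, and Cartan's formula is used backwards on the evolution of `w`.
    refine (cart _).trans ?_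
    refine (congrArg Neg.neg (evol _)).trans ?_
    refine Eq.trans ?_ (congrArg (fun u => smoothRestrict hL ((smoothSuperalgebra hW).pb _ u) + _)
      (cart _)).symm
    rw [← neg_one_smul ℝ (smoothRestrict hL _), DiffSuperalgebra.pb_smul_right, map_smul,
      neg_one_smul, neg_add, pow_succ, mul_neg_one, neg_smul]
    rfl

end Global

end WeakKoszul

end

open scoped Manifold ContDiff in
open WeakKoszul in
theorem proposition3 {n m k : ℕ} {M : Type*} [TopologicalSpace M]
    [ChartedSpace (EuclideanSpace ℝ (Fin n)) M] [IsManifold (𝓡 n) ∞ M]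
    {E : M → Type*} [∀ x, AddCommGroup (E x)] [∀ x, Module ℝ (E x)]
    [∀ x, TopologicalSpace (E x)] [TopologicalSpace (Bundle.TotalSpace (Fin m → ℝ) E)]
    [FiberBundle (Fin m → ℝ) E] [VectorBundle ℝ (Fin m → ℝ) E]
    [ContMDiffVectorBundle ∞ (Fin m → ℝ) E (𝓡 n)]
    {F : M → Type*} [∀ x, AddCommGroup (F x)] [∀ x, Module ℝ (F x)]
    [∀ x, TopologicalSpace (F x)] [TopologicalSpace (Bundle.TotalSpace (Fin k → ℝ) F)]
    [FiberBundle (Fin k → ℝ) F] [VectorBundle ℝ (Fin k → ℝ) F]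
    [ContMDiffVectorBundle ∞ (Fin k → ℝ) F (𝓡 n)]
    (S V X w : LocalFamily (n := n) (m := m) (k := k) E F)
    (hS : IsMasterFunction S)
    (hV : IsProjectibleVectorField S V ∨ IsWeakPoissonVectorField S V)
    (hVparity : HasParity 1 V) (hVghost : HasGhost 1 V)
    (hX : IsProjectibleVectorField S X) (εX : ℕ) (hXparity : HasParity εX X)
    (hw : IsProjectibleForm S w) :
    ∀ c, Set.EqOn
        (timeDeriv (V c) (interior (X c) (w c)))
        (interior (X c) (timeDeriv (V c) (w c))
          + (-1 : ℝ) ^ εX • restrictL (bracket (oddBracket (V c) (X c)) (w c)))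
        c.domain ∧
      Set.EqOn
        (lieDeriv (V c) (interior (X c) (w c)))
        (interior (X c) (lieDeriv (V c) (w c))
          + (-1 : ℝ) ^ (εX + 1) • restrictL (bracket (oddBracket (V c) (X c)) (w c)))
        c.domain := by
  intro c
  have hVN : IsFunctionOnN V := hV.elim (·.onN) (·.onN)
  have hVdeg : HasPositiveDeg V := hV.elim (fun h => h.deg.hasPositiveDeg h.onN.1) (·.deg)
  exact timeDeriv_lieDeriv_interior c.isOpen_domain (c.mapsTo_domain fun _ => rfl)
    (c.mapsTo_domain fun _ => rfl) (hVN.1.smooth c) (hX.onN.1.smooth c) (hw.onL.1.smooth c)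
    (hVparity c) (hXparity c) (hVN.2 c) (hX.onN.2 c) (hVdeg.restrictL_eqOn c)
    ((hX.deg.hasPositiveDeg hX.onN.1).restrictL_eqOn c)
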